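/- Let $\mathfrak{g}=\mathfrak{sl}_2(\mathbb{C})$ with standard basis $e,h,f$, let $\mathfrak{T}=\mathfrak{sl}_2\otimes\mathbb{C}[x]/(x^2)$ be the associated Takiff Lie algebra with bracket $[v\otimes x^i,w\otimes x^j]=[v,w]\otimes x^{i+j}$, and write $v=v\otimes 1$, $\bar v=v\otimes x$ for $v\in\mathfrak{sl}_2$. Let $U=U(\mathfrak{T})$, let $Z(\mathfrak{T})$ be the centre of $U$, and let $$C=\bar h h+2\bar f e+2\bar e f,\qquad \bar C=\bar h^2+4\bar f\bar e ,$$ which are elements of $Z(\mathfrak{T})$. For $\lambda_1,\lambda_2\in\mathbb{C}$ let $\Delta(\lambda_1,\lambda_2)$ be the Verma module, i.e. the $U$-module induced from the one-dimensional module of the subalgebra spanned by $h,\bar h,e,\bar e$ on which $e,\bar e$ act by $0$, $h$ by $\lambda_1$ and $\bar h$ by $\lambda_2$. Let $U_{(f)}$ be the Ore localization of $U$ at the powers of $f$, let $S_f=U_{(f)}/U$ (a $U$-$U$-bimodule), and for $n\in\mathbb{Z}$, $\lambda_2\neq0$ let $$V(n,\lambda_2)=\{m\in S_f\otimes_U\Delta(n-2,\lambda_2)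 : \dim \mathbb{C}[e]m<\infty\},$$ a $U$-submodule of $S_f\otimes_U\Delta(n-2,\lambda_2)$. Theorem. Let $n\in\mathbb{Z}$ and $\lambda_2\in\mathbb{C}\setminus\{0\}$. Then $$\operatorname{Ann}_U V(n,\lambda_2)=\operatorname{Ann}_U\Delta(n-2,\lambda_2)=\operatorname{Ann}_U\Delta(-n-2,-\lambda_2).$$ There is a unique homomorphism of $\mathbb{C}$-algebras $\chi\colon Z(\mathfrak{T})\to\mathbb{C}$ with $\chi(C)=n\lambda_2$ and $\chi(\bar C)=\lambda_2^2$, and the above annihilator is the centrally generated ideal $$U\cdot\operatorname{Ker}\chi = U\,(C-n\lambda_2)+U\,(\bar C-\lambda_2^2).$$ -/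

import Mathlib

open scoped TensorProduct
open LieAlgebra.SpecialLinear (sl)

noncomputable section

namespace TakiffSl2

/-! ### The Takiff Lie algebra of `sl₂` -/

/-- The Lie algebra `sl₂` over `ℂ`. -/
abbrev Sl2 : Type := sl (Fin 2) ℂ

/-- The Takiff Lie algebra `𝔻 ⊗ sl₂`, where `𝔻 = ℂ[x]/(x²)`, as a complex Lie algebra with
bracket `[a ⊗ v, b ⊗ w] = ab ⊗ [v, w]`. -/
def T : Type := DualNumber ℂ ⊗[ℂ] Sl2

instance lieRingT : LieRing T := inferInstanceAs (LieRing (DualNumber ℂ ⊗[ℂ] Sl2))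
instance lieAlgebraT : LieAlgebra ℂ T := inferInstanceAs (LieAlgebra ℂ (DualNumber ℂ ⊗[ℂ] Sl2))

/-- The standard basis of `sl₂`. -/
def e₀ : Sl2 := ⟨!![0, 1; 0, 0], by simp [sl, Matrix.trace_fin_two]⟩
def f₀ : Sl2 := ⟨!![0, 0; 1, 0], by simp [sl, Matrix.trace_fin_two]⟩
def h₀ : Sl2 := ⟨!![1, 0; 0, -1], by simp [sl, Matrix.trace_fin_two]⟩

/-- The copy of `v ∈ sl₂` in the Takiff algebra. -/
def unbar (v : Sl2) : T := (1 : DualNumber ℂ) ⊗ₜ[ℂ] v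

/-- The element `v̄` of the Takiff algebra, for `v ∈ sl₂`. -/
def bar (v : Sl2) : T := (DualNumber.eps : DualNumber ℂ) ⊗ₜ[ℂ] v

lemma lie_ef : ⁅e₀, f₀⁆ = h₀ := by
  apply Subtype.ext
  rw [LieAlgebra.SpecialLinear.sl_bracket]
  ext i j; fin_cases i <;> fin_cases j <;> simp [e₀, f₀, h₀]

lemma lie_he : ⁅h₀, e₀⁆ = (2 : ℂ) • e₀ := by
  apply Subtype.ext
  rw [LieAlgebra.SpecialLinear.sl_bracket]
  ext i j; fin_cases i <;> fin_cases j <;> simp [e₀, h₀] <;> norm_num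

lemma lie_hf : ⁅h₀, f₀⁆ = (-2 : ℂ) • f₀ := by
  apply Subtype.ext
  rw [LieAlgebra.SpecialLinear.sl_bracket]
  ext i j; fin_cases i <;> fin_cases j <;> simp [f₀, h₀] <;> norm_num

lemma tmul_lie_tmul (a b : DualNumber ℂ) (v w : Sl2) :
    ⁅(a ⊗ₜ[ℂ] v : DualNumber ℂ ⊗[ℂ] Sl2), (b ⊗ₜ[ℂ] w : DualNumber ℂ ⊗[ℂ] Sl2)⁆ =
      (a * b) ⊗ₜ[ℂ] ⁅v, w⁆ := by
  simp

lemma lie_unbar_unbar (v w : Sl2) : ⁅unbar v, unbar w⁆ = unbar ⁅v, w⁆ :=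
  (tmul_lie_tmul 1 1 v w).trans (by rw [one_mul]; rfl)

lemma lie_unbar_bar (v w : Sl2) : ⁅unbar v, bar w⁆ = bar ⁅v, w⁆ :=
  (tmul_lie_tmul 1 DualNumber.eps v w).trans (by rw [one_mul]; rfl)

lemma lie_bar_bar (v w : Sl2) : ⁅bar v, bar w⁆ = 0 :=
  (tmul_lie_tmul DualNumber.eps DualNumber.eps v w).trans
    (by rw [DualNumber.eps_mul_eps, TensorProduct.zero_tmul]; rfl)

lemma bar_add (v w : Sl2) : bar (v + w) = bar v + bar w := TensorProduct.tmul_add _ _ _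
lemma unbar_add (v w : Sl2) : unbar (v + w) = unbar v + unbar w := TensorProduct.tmul_add _ _ _
lemma bar_smul (c : ℂ) (v : Sl2) : bar (c • v) = c • bar v := TensorProduct.tmul_smul _ _ _
lemma unbar_smul (c : ℂ) (v : Sl2) : unbar (c • v) = c • unbar v := TensorProduct.tmul_smul _ _ _
lemma bar_zero : bar 0 = 0 := TensorProduct.tmul_zero _ _
lemma unbar_zero : unbar 0 = 0 := TensorProduct.tmul_zero _ _

lemma sl2_eq (v : Sl2) : v = v.1 0 1 • e₀ + v.1 1 0 • f₀ + v.1 0 0 • h₀ := by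
  have hv : v.1 0 0 + v.1 1 1 = 0 := by
    have := v.2
    simpa [sl, Matrix.trace_fin_two] using this
  apply Subtype.ext
  ext i j
  fin_cases i <;> fin_cases j <;> simp [e₀, f₀, h₀]
  linear_combination hv

/-- Every element of the Takiff algebra is of the form `v + w̄`. -/
lemma exists_eq (x : T) : ∃ v w : Sl2, x = unbar v + bar w := by
  refine TensorProduct.induction_on (R := ℂ) (M := DualNumber ℂ) (N := Sl2)
    (motive := fun x => ∃ v w : Sl2, (x : T) = unbar v + bar w) x ?_ ?_ ?_
  · exact ⟨0, 0, by rw [unbar_zero, bar_zero, add_zero]; rfl⟩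
  · intro a v
    refine ⟨a.fst • v, a.snd • v, ?_⟩
    change a ⊗ₜ[ℂ] v = (1 : DualNumber ℂ) ⊗ₜ[ℂ] (a.fst • v) +
      (DualNumber.eps : DualNumber ℂ) ⊗ₜ[ℂ] (a.snd • v)
    rw [← TensorProduct.smul_tmul, ← TensorProduct.smul_tmul, ← TensorProduct.add_tmul]
    congr 1
    ext <;> simp
  · rintro x y ⟨v, w, hx⟩ ⟨v', w', hy⟩
    refine ⟨v + v', w + w', ?_⟩
    rw [unbar_add, bar_add, add_add_add_comm, ← hx, ← hy]
    rfl

/-! ### The universal enveloping algebra -/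

/-- The universal enveloping algebra of the Takiff algebra. -/
abbrev U : Type := UniversalEnvelopingAlgebra ℂ T

/-- The image in `U` of an element of the Takiff algebra. -/
def inc (x : T) : U := UniversalEnvelopingAlgebra.ι ℂ x

def e : U := inc (unbar e₀)
def f : U := inc (unbar f₀)
def h : U := inc (unbar h₀)
def eb : U := inc (bar e₀)
def fb : U := inc (bar f₀)
def hb : U := inc (bar h₀)

lemma inc_add (x y : T) : inc (x + y) = inc x + inc y := by simp [inc]
lemma inc_smul (c : ℂ) (x : T) : inc (c • x) = c • inc x := by simp [inc]
lemma inc_zero : inc 0 = 0 := by simp [inc]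

attribute [local instance 100] LieRing.ofAssociativeRing in
lemma inc_lie (x y : T) : inc x * inc y - inc y * inc x = inc ⁅x, y⁆ := by
  unfold inc
  rw [LieHom.map_lie, LieRing.of_associative_ring_bracket]

attribute [local instance 100] LieRing.ofAssociativeRing in
/-- The enveloping algebra is generated by the Lie algebra. -/
lemma adjoin_inc : Algebra.adjoin ℂ (Set.range inc) = ⊤ := by
  set A := Algebra.adjoin ℂ (Set.range inc) with hA
  let g : T →ₗ⁅ℂ⁆ A :=
    { toFun := fun x => ⟨inc x, Algebra.subset_adjoin ⟨x, rfl⟩⟩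
      map_add' := fun x y => Subtype.ext (inc_add x y)
      map_smul' := fun c x => Subtype.ext (inc_smul c x)
      map_lie' := fun {x y} => Subtype.ext (inc_lie x y).symm }
  have key : A.val.comp (UniversalEnvelopingAlgebra.lift ℂ g) = AlgHom.id ℂ U := by
    apply UniversalEnvelopingAlgebra.hom_ext
    ext x
    have : UniversalEnvelopingAlgebra.lift ℂ g (UniversalEnvelopingAlgebra.ι ℂ x) = g x :=
      UniversalEnvelopingAlgebra.lift_ι_apply ℂ g x
    simp only [LieHom.comp_apply, AlgHom.coe_toLieHom, AlgHom.comp_apply, this]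
    rfl
  rw [eq_top_iff]
  intro u _
  have : A.val (UniversalEnvelopingAlgebra.lift ℂ g u) = u := DFunLike.congr_fun key u
  rw [← this]
  exact Subtype.property _

lemma U_induction {P : U → Prop} (halg : ∀ c : ℂ, P (algebraMap ℂ U c)) (hinc : ∀ x, P (inc x))
    (hadd : ∀ u v, P u → P v → P (u + v)) (hmul : ∀ u v, P u → P v → P (u * v)) (u : U) : P u := by
  have hu : u ∈ Algebra.adjoin ℂ (Set.range inc) := by rw [adjoin_inc]; trivial
  induction hu using Algebra.adjoin_induction with
  | mem x hx => obtain ⟨y, rfl⟩ := hx; exact hinc y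
  | algebraMap r => exact halg r
  | add x y _ _ hx hy => exact hadd x y hx hy
  | mul x y _ _ hx hy => exact hmul x y hx hy

/-- Every element of the Takiff algebra is a combination of the standard basis. -/
lemma inc_eq (x : T) : ∃ a b c a' b' c' : ℂ,
    inc x = a • e + b • f + c • h + a' • eb + b' • fb + c' • hb := by
  obtain ⟨v, w, rfl⟩ := exists_eq x
  refine ⟨v.1 0 1, v.1 1 0, v.1 0 0, w.1 0 1, w.1 1 0, w.1 0 0, ?_⟩
  have h1 : inc (unbar v) = v.1 0 1 • e + v.1 1 0 • f + v.1 0 0 • h := by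
    conv_lhs => rw [sl2_eq v]
    simp only [unbar_add, unbar_smul, inc_add, inc_smul, e, f, h]
  have h2 : inc (bar w) = w.1 0 1 • eb + w.1 1 0 • fb + w.1 0 0 • hb := by
    conv_lhs => rw [sl2_eq w]
    simp only [bar_add, bar_smul, inc_add, inc_smul, eb, fb, hb]
  rw [inc_add, h1, h2]
  abel

lemma U_induction' {P : U → Prop} (halg : ∀ c : ℂ, P (algebraMap ℂ U c))
    (he : P e) (hf : P f) (hh : P h) (heb : P eb) (hfb : P fb) (hhb : P hb)
    (hadd : ∀ u v, P u → P v → P (u + v)) (hmul : ∀ u v, P u → P v → P (u * v)) (u : U) : P u := by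
  have hs : ∀ (c : ℂ) (u : U), P u → P (c • u) := fun c u hu => by
    rw [Algebra.smul_def]; exact hmul _ _ (halg c) hu
  refine U_induction halg (fun x => ?_) hadd hmul u
  obtain ⟨a, b, c, a', b', c', hx⟩ := inc_eq x
  rw [hx]
  exact hadd _ _ (hadd _ _ (hadd _ _ (hadd _ _ (hadd _ _ (hs _ _ he) (hs _ _ hf)) (hs _ _ hh))
    (hs _ _ heb)) (hs _ _ hfb)) (hs _ _ hhb)

/-! Commutation relations between the generators of `U`. -/

lemma two_smul' (u : U) : (2 : ℂ) • u = 2 * u := by rw [two_smul, two_mul]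
lemma neg_two_smul' (u : U) : (-2 : ℂ) • u = -(2 * u) := by rw [neg_smul, two_smul']

lemma comm_ef : e * f = f * e + h := by
  have := inc_lie (unbar e₀) (unbar f₀)
  rw [lie_unbar_unbar, lie_ef] at this
  exact sub_eq_iff_eq_add'.1 this

lemma comm_he : h * e = e * h + 2 * e := by
  have := inc_lie (unbar h₀) (unbar e₀)
  rw [lie_unbar_unbar, lie_he, unbar_smul, inc_smul, two_smul'] at this
  exact sub_eq_iff_eq_add'.1 this

lemma comm_hf : h * f = f * h - 2 * f := by
  have := inc_lie (unbar h₀) (unbar f₀)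
  rw [lie_unbar_unbar, lie_hf, unbar_smul, inc_smul, neg_two_smul'] at this
  rw [sub_eq_add_neg]
  exact sub_eq_iff_eq_add'.1 this

lemma comm_e_eb : e * eb = eb * e := by
  have := inc_lie (unbar e₀) (bar e₀)
  rw [lie_unbar_bar, lie_self, bar_zero, inc_zero] at this
  exact sub_eq_zero.1 this

lemma comm_f_fb : f * fb = fb * f := by
  have := inc_lie (unbar f₀) (bar f₀)
  rw [lie_unbar_bar, lie_self, bar_zero, inc_zero] at this
  exact sub_eq_zero.1 this

lemma comm_h_hb : h * hb = hb * h := by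
  have := inc_lie (unbar h₀) (bar h₀)
  rw [lie_unbar_bar, lie_self, bar_zero, inc_zero] at this
  exact sub_eq_zero.1 this

lemma comm_e_fb : e * fb = fb * e + hb := by
  have := inc_lie (unbar e₀) (bar f₀)
  rw [lie_unbar_bar, lie_ef] at this
  exact sub_eq_iff_eq_add'.1 this

lemma comm_f_eb : f * eb = eb * f - hb := by
  have := inc_lie (unbar f₀) (bar e₀)
  rw [lie_unbar_bar, ← lie_skew, lie_ef, ← neg_one_smul ℂ, bar_smul,
    inc_smul, neg_one_smul] at this
  rw [sub_eq_add_neg]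
  exact sub_eq_iff_eq_add'.1 this

lemma comm_h_eb : h * eb = eb * h + 2 * eb := by
  have := inc_lie (unbar h₀) (bar e₀)
  rw [lie_unbar_bar, lie_he, bar_smul, inc_smul, two_smul'] at this
  exact sub_eq_iff_eq_add'.1 this

lemma comm_h_fb : h * fb = fb * h - 2 * fb := by
  have := inc_lie (unbar h₀) (bar f₀)
  rw [lie_unbar_bar, lie_hf, bar_smul, inc_smul, neg_two_smul'] at this
  rw [sub_eq_add_neg]
  exact sub_eq_iff_eq_add'.1 this

lemma comm_e_hb : e * hb = hb * e - 2 * eb := by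
  have := inc_lie (unbar e₀) (bar h₀)
  rw [lie_unbar_bar, ← lie_skew, lie_he, ← neg_smul, bar_smul, inc_smul, neg_two_smul'] at this
  rw [sub_eq_add_neg]
  exact sub_eq_iff_eq_add'.1 this

lemma comm_f_hb : f * hb = hb * f + 2 * fb := by
  have := inc_lie (unbar f₀) (bar h₀)
  rw [lie_unbar_bar, ← lie_skew, lie_hf, ← neg_smul, neg_neg, bar_smul, inc_smul,
    two_smul'] at this
  exact sub_eq_iff_eq_add'.1 this

lemma comm_bar (v w : Sl2) : inc (bar v) * inc (bar w) = inc (bar w) * inc (bar v) := by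
  have := inc_lie (bar v) (bar w)
  rw [lie_bar_bar, inc_zero] at this
  exact sub_eq_zero.1 this

lemma comm_eb_fb : eb * fb = fb * eb := comm_bar _ _
lemma comm_eb_hb : eb * hb = hb * eb := comm_bar _ _
lemma comm_hb_fb : hb * fb = fb * hb := comm_bar _ _

/-! ### The centre -/

/-- The element `C = h̄h + 2f̄e + 2ēf`. -/
def casimir : U := hb * h + 2 * (fb * e) + 2 * (eb * f)

/-- The element `C̄ = h̄² + 4f̄ē`. -/
def casimirBar : U := hb ^ 2 + 4 * (fb * eb)

lemma mem_center_of {z : U} (he : z * e = e * z) (hf : z * f = f * z) (hh : z * h = h * z)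
    (heb : z * eb = eb * z) (hfb : z * fb = fb * z) (hhb : z * hb = hb * z) :
    z ∈ Subalgebra.center ℂ U := by
  rw [Subalgebra.mem_center_iff]
  intro u
  refine U_induction' (P := fun u => u * z = z * u) (fun c => Algebra.commutes c z) he.symm hf.symm
    hh.symm heb.symm hfb.symm hhb.symm ?_ ?_ u
  · intro u v hu hv; rw [add_mul, mul_add, hu, hv]
  · intro u v hu hv; rw [mul_assoc, hv, ← mul_assoc, hu, mul_assoc]


lemma assoc_of {a b c : U} (hab : a * b = c) (x : U) : a * (b * x) = c * x := by
  rw [← mul_assoc, hab]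

lemma casimir_mem_center : casimir ∈ Subalgebra.center ℂ U := by
  apply mem_center_of <;>
    simp only [casimir, mul_add, add_mul, mul_sub, sub_mul, mul_assoc, two_mul, comm_ef, comm_he,
      comm_hf, comm_e_eb, comm_f_fb, comm_h_hb, comm_e_fb, comm_f_eb, comm_h_eb, comm_h_fb,
      comm_e_hb, comm_f_hb, comm_eb_fb, comm_eb_hb, comm_hb_fb, assoc_of comm_ef,
      assoc_of comm_he, assoc_of comm_hf, assoc_of comm_e_eb, assoc_of comm_f_fb,
      assoc_of comm_h_hb, assoc_of comm_e_fb, assoc_of comm_f_eb, assoc_of comm_h_eb,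
      assoc_of comm_h_fb, assoc_of comm_e_hb, assoc_of comm_f_hb, assoc_of comm_eb_fb,
      assoc_of comm_eb_hb, assoc_of comm_hb_fb] <;> abel

lemma casimirBar_mem_center : casimirBar ∈ Subalgebra.center ℂ U := by
  have h4 : ∀ u : U, 4 * u = u + u + u + u := fun u => by noncomm_ring
  apply mem_center_of <;>
    simp only [casimirBar, h4, pow_two, mul_add, add_mul, mul_sub, sub_mul, mul_assoc, two_mul,
      comm_e_eb, comm_f_fb, comm_h_hb, comm_e_fb, comm_f_eb, comm_h_eb, comm_h_fb,
      comm_e_hb, comm_f_hb, comm_eb_fb, comm_eb_hb, comm_hb_fb,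
      assoc_of comm_e_eb, assoc_of comm_f_fb,
      assoc_of comm_h_hb, assoc_of comm_e_fb, assoc_of comm_f_eb, assoc_of comm_h_eb,
      assoc_of comm_h_fb, assoc_of comm_e_hb, assoc_of comm_f_hb, assoc_of comm_eb_fb,
      assoc_of comm_eb_hb, assoc_of comm_hb_fb] <;> abel

/-- The centre `Z` of the enveloping algebra. -/
abbrev Z : Subalgebra ℂ U := Subalgebra.center ℂ U

/-- `C` and `C̄` as elements of the centre. -/
def C : Z := ⟨casimir, casimir_mem_center⟩
def Cbar : Z := ⟨casimirBar, casimirBar_mem_center⟩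

/-- The left ideal `U · Ker χ` (it is two-sided, as `Ker χ` is central). -/
def idealOfKer (χ : Z →ₐ[ℂ] ℂ) : Ideal U := Ideal.span (Subtype.val '' {z : Z | χ z = 0})

/-! ### Verma modules -/

/-- The left ideal generated by the elements `x - λ(x)`, for `x` in the standard basis
`e, ē, h, h̄` of the Borel subalgebra, where `λ(e) = λ(ē) = 0`, `λ(h) = l₁`, `λ(h̄) = l₂`. -/
def vermaIdeal (l₁ l₂ : ℂ) : Submodule U U :=
  Submodule.span U {e, eb, h - algebraMap ℂ U l₁, hb - algebraMap ℂ U l₂}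

/-- The Verma module `Δ(l₁, l₂)`: the module induced from the character `λ` of the Borel
subalgebra spanned by `e, ē, h, h̄`, that is, the `U`-module generated by one vector `v` subject
to `e v = ē v = 0`, `h v = l₁ v`, `h̄ v = l₂ v`. -/
abbrev Verma (l₁ l₂ : ℂ) : Type := U ⧸ vermaIdeal l₁ l₂

/-! ### Localisation at `f` -/

/-- The derivation `[f, -]` of `U`. -/
def adf (u : U) : U := f * u - u * f

lemma adf_mul (u v : U) : adf (u * v) = adf u * v + u * adf v := by
  unfold adf; noncomm_ring

lemma adf_add (u v : U) : adf (u + v) = adf u + adf v := by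
  unfold adf; noncomm_ring

lemma adf_zero : adf 0 = 0 := by simp [adf]

lemma adf_iter_zero (k : ℕ) : adf^[k] 0 = 0 := Function.iterate_fixed adf_zero k

lemma adf_iter_add (k : ℕ) (u v : U) : adf^[k] (u + v) = adf^[k] u + adf^[k] v := by
  induction k generalizing u v with
  | zero => rfl
  | succ k ih => simp only [Function.iterate_succ_apply, adf_add, ih]

lemma adf_iter_mul (n a b : ℕ) (hn : a + b ≤ n) (u v : U) (hu : adf^[a] u = 0)
    (hv : adf^[b] v = 0) : adf^[n] (u * v) = 0 := by
  induction n generalizing a b u v with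
  | zero =>
    obtain rfl : a = 0 := by omega
    simp only [Function.iterate_zero, id] at hu
    simp [hu]
  | succ n ih =>
    rcases Nat.eq_zero_or_pos a with rfl | ha
    · simp only [Function.iterate_zero, id] at hu
      rw [hu, zero_mul, adf_iter_zero]
    rcases Nat.eq_zero_or_pos b with rfl | hb
    · simp only [Function.iterate_zero, id] at hv
      rw [hv, mul_zero, adf_iter_zero]
    obtain ⟨a, rfl⟩ : ∃ a', a = a' + 1 := ⟨a - 1, by omega⟩
    obtain ⟨b, rfl⟩ : ∃ b', b = b' + 1 := ⟨b - 1, by omega⟩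
    rw [Function.iterate_succ_apply, adf_mul, adf_iter_add,
      ih a (b + 1) (by omega) _ _ (by rwa [Function.iterate_succ_apply] at hu) hv,
      ih (a + 1) b (by omega) _ _ hu (by rwa [Function.iterate_succ_apply] at hv), add_zero]

/-- The derivation `[f, -]` is locally nilpotent on `U`. -/
lemma adf_nilpotent (u : U) : ∃ k, adf^[k] u = 0 := by
  have mono : ∀ {k l : ℕ} {u : U}, k ≤ l → adf^[k] u = 0 → adf^[l] u = 0 := by
    intro k l u hkl hu
    obtain ⟨m, rfl⟩ := Nat.exists_eq_add_of_le' hkl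
    rw [Function.iterate_add_apply, hu, adf_iter_zero]
  have dh : adf h = 2 * f := by rw [adf, comm_hf]; abel
  have dhb : adf hb = 2 * fb := by rw [adf, comm_f_hb]; abel
  have df : adf f = 0 := by simp [adf]
  have dfb : adf fb = 0 := by rw [adf, comm_f_fb, sub_self]
  have d2f : adf (2 * f) = 0 := by rw [two_mul, adf_add, df, add_zero]
  have d2fb : adf (2 * fb) = 0 := by rw [two_mul, adf_add, dfb, add_zero]
  have hneg : ∀ u, adf (-u) = -adf u := fun u => by unfold adf; noncomm_ring
  have de : adf e = -h := by rw [adf, comm_ef]; abel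
  have deb : adf eb = -hb := by rw [adf, comm_f_eb]; abel
  refine U_induction' (P := fun u => ∃ k, adf^[k] u = 0) (fun c => ⟨1, ?_⟩)
    ⟨3, ?_⟩ ⟨1, ?_⟩ ⟨2, ?_⟩ ⟨3, ?_⟩ ⟨1, ?_⟩ ⟨2, ?_⟩ ?_ ?_ u
  · simp [adf, Algebra.commutes]
  · simp [de, dh, d2f, hneg]
  · simp [df]
  · simp [dh, d2f]
  · simp [deb, dhb, d2fb, hneg]
  · simp [dfb]
  · simp [dhb, d2fb]
  · rintro u v ⟨k, hk⟩ ⟨l, hl⟩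
    refine ⟨max k l, ?_⟩
    rw [adf_iter_add, mono (le_max_left k l) hk, mono (le_max_right k l) hl, add_zero]
  · rintro u v ⟨k, hk⟩ ⟨l, hl⟩
    exact ⟨k + l, adf_iter_mul _ _ _ le_rfl _ _ hk hl⟩

/-- If a left ideal `I` is stable under right multiplication by `f` and `u f ^ n ∈ I`, then
`f ^ m u ∈ I` for some `m`. -/
lemma exists_pow_mul_mem (I : Submodule U U) (hI : ∀ u ∈ I, u * f ∈ I) (n k : ℕ) (u : U)
    (hk : adf^[k] u = 0) (hu : u * f ^ n ∈ I) : ∃ m : ℕ, f ^ m * u ∈ I := by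
  induction k generalizing u with
  | zero => exact ⟨0, by simp_all⟩
  | succ k ih =>
    have hd : adf u * f ^ n ∈ I := by
      have : adf u * f ^ n = f * (u * f ^ n) - (u * f ^ n) * f := by
        rw [adf, sub_mul, mul_assoc, mul_assoc u f, mul_assoc u, ← pow_succ', ← pow_succ]
      rw [this]
      exact I.sub_mem (I.smul_mem f hu) (hI _ hu)
    obtain ⟨m, hm⟩ := ih (adf u) (by rwa [Function.iterate_succ_apply] at hk) hd
    have key : ∀ j : ℕ, f ^ (m + j) * u - f ^ m * u * f ^ j ∈ I := by
      intro j
      induction j with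
      | zero => simp
      | succ j ihj =>
        have : f ^ (m + (j + 1)) * u - f ^ m * u * f ^ (j + 1) =
            f ^ j * (f ^ m * adf u) + (f ^ (m + j) * u - f ^ m * u * f ^ j) * f := by
          have h1 : f ^ j * (f ^ m * adf u) = f ^ (m + (j + 1)) * u - f ^ (m + j) * u * f := by
            rw [← mul_assoc, ← pow_add, add_comm j m, adf, mul_sub, ← mul_assoc, ← pow_succ,
              ← mul_assoc, add_assoc]
          rw [h1, sub_mul, mul_assoc (f ^ m * u), ← pow_succ]
          abel
        rw [this]
        exact I.add_mem (I.smul_mem _ hm) (hI _ ihj)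
    refine ⟨m + n, ?_⟩
    have h2 : f ^ m * u * f ^ n ∈ I := by
      rw [mul_assoc]; exact I.smul_mem _ hu
    simpa using I.add_mem (key n) h2

/-- The multiplicative set `{1, f, f², …}` satisfies the Ore conditions. -/
lemma nonempty_oreSet : Nonempty (OreLocalization.OreSet (Submonoid.powers f)) := by
  rw [OreLocalization.nonempty_oreSet_iff]
  constructor
  · rintro r₁ r₂ ⟨_, n, rfl⟩ hr
    obtain ⟨k, hk⟩ := adf_nilpotent (r₁ - r₂)
    obtain ⟨m, hm⟩ := exists_pow_mul_mem ⊥ (by simp) n k (r₁ - r₂) hk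
      (by simp only [Submodule.mem_bot, sub_mul]; exact sub_eq_zero.2 hr)
    refine ⟨⟨f ^ m, m, rfl⟩, ?_⟩
    simp only [Submodule.mem_bot, mul_sub] at hm
    exact sub_eq_zero.1 hm
  · rintro r ⟨_, n, rfl⟩
    obtain ⟨k, hk⟩ := adf_nilpotent r
    obtain ⟨m, hm⟩ := exists_pow_mul_mem (Submodule.span U {f ^ n})
      (by
        intro u hu
        obtain ⟨a, rfl⟩ := Submodule.mem_span_singleton.1 hu
        refine Submodule.mem_span_singleton.2 ⟨a * f, ?_⟩
        simp only [smul_eq_mul, mul_assoc, ← pow_succ, ← pow_succ'])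
      n k r hk (Submodule.mem_span_singleton.2 ⟨r, rfl⟩)
    obtain ⟨a, ha⟩ := Submodule.mem_span_singleton.1 hm
    exact ⟨a, ⟨f ^ m, m, rfl⟩, ha.symm⟩

instance oreSet : OreLocalization.OreSet (Submonoid.powers f) := nonempty_oreSet.some

instance finite_dualNumber : Module.Finite ℂ (DualNumber ℂ) :=
  inferInstanceAs (Module.Finite ℂ (ℂ × ℂ))

instance finite_T : Module.Finite ℂ T :=
  inferInstanceAs (Module.Finite ℂ (DualNumber ℂ ⊗[ℂ] Sl2))

section Completion

variable (M : Type) [AddCommGroup M] [Module ℂ M] [Module U M] [IsScalarTower ℂ U M]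

/-- The localisation `U_(f) ⊗_U M` of a module, consisting of fractions `f⁻ᵏ m`. -/
abbrev Loc : Type := OreLocalization (Submonoid.powers f) M

/-- The canonical map `j : M → U_(f) ⊗_U M`, `m ↦ 1 ⊗ m`. -/
def toLoc : M →ₗ[U] Loc M where
  toFun m := OreLocalization.oreDiv m 1
  map_add' _ _ := OreLocalization.add_oreDiv.symm
  map_smul' r m := (OreLocalization.smul_oreDiv_one r m).symm

/-- The twisted module `S_f ⊗_U M`, where `S_f = U_(f) / U`, as the quotient of `U_(f) ⊗_U M` by
the image of `M` (these agree by right exactness of the tensor product). -/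
abbrev Twist : Type := Loc M ⧸ LinearMap.range (toLoc M)

variable {M}

/-- The action of `e` on `m` is locally finite: `dim ℂ[e] m < ∞`. -/
def IsLocallyFinite (m : M) : Prop :=
  FiniteDimensional ℂ (Submodule.span ℂ (Set.range fun k : ℕ => e ^ k • m))

/-- The operator by which an element of `U` acts on `M`. -/
def act (u : U) : M →ₗ[ℂ] M where
  toFun m := u • m
  map_add' := smul_add u
  map_smul' c m := by
    rw [RingHom.id_apply, ← algebraMap_smul U c m, ← mul_smul, ← Algebra.commutes, mul_smul,
      algebraMap_smul]

lemma isLocallyFinite_iff (m : M) : IsLocallyFinite m ↔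
    ∃ W : Submodule ℂ M, FiniteDimensional ℂ W ∧ m ∈ W ∧ ∀ w ∈ W, e • w ∈ W := by
  constructor
  · intro hm
    refine ⟨_, hm, Submodule.subset_span ⟨0, by simp⟩, ?_⟩
    intro w hw
    have : Submodule.span ℂ (Set.range fun k : ℕ => e ^ k • m) ≤
        (Submodule.span ℂ (Set.range fun k : ℕ => e ^ k • m)).comap (act e) := by
      rw [Submodule.span_le]
      rintro _ ⟨k, rfl⟩
      refine Submodule.subset_span ⟨k + 1, ?_⟩
      simp [act, pow_succ', mul_smul]
    exact this hw
  · rintro ⟨W, hW, hm, hst⟩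
    have : Submodule.span ℂ (Set.range fun k : ℕ => e ^ k • m) ≤ W := by
      rw [Submodule.span_le]
      rintro _ ⟨k, rfl⟩
      change e ^ k • m ∈ W
      induction k with
      | zero => simpa using hm
      | succ k ih => rw [pow_succ', mul_smul]; exact hst _ ih
    exact Submodule.finiteDimensional_of_le this

lemma IsLocallyFinite.add {m m' : M} (hm : IsLocallyFinite m) (hm' : IsLocallyFinite m') :
    IsLocallyFinite (m + m') := by
  rw [isLocallyFinite_iff] at *
  obtain ⟨W, _, h1, h2⟩ := hm
  obtain ⟨W', _, h1', h2'⟩ := hm'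
  refine ⟨W ⊔ W', inferInstance, Submodule.add_mem_sup h1 h1', ?_⟩
  intro w hw
  obtain ⟨a, ha, b, hb, rfl⟩ := Submodule.mem_sup.1 hw
  rw [smul_add]
  exact Submodule.add_mem_sup (h2 a ha) (h2' b hb)

lemma IsLocallyFinite.smul {m : M} (hm : IsLocallyFinite m) (u : U) : IsLocallyFinite (u • m) := by
  induction u using U_induction generalizing m with
  | halg c =>
    rw [isLocallyFinite_iff] at *
    obtain ⟨W, hW, h1, h2⟩ := hm
    exact ⟨W, hW, by rw [algebraMap_smul]; exact W.smul_mem c h1, h2⟩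
  | hinc x =>
    rw [isLocallyFinite_iff] at *
    obtain ⟨W, hW, h1, h2⟩ := hm
    let b : T →ₗ[ℂ] M →ₗ[ℂ] M :=
      { toFun := fun x => act (inc x)
        map_add' := fun x y => by ext m; simp [act, inc_add, add_smul]
        map_smul' := fun c x => by ext m; simp [act, inc_smul] }
    refine ⟨Submodule.map₂ b ⊤ W, ?_, Submodule.apply_mem_map₂ b (Submodule.mem_top (x := x)) h1, ?_⟩
    · rw [FiniteDimensional, Module.Finite.iff_fg]
      exact Submodule.FG.map₂ b Module.Finite.fg_top (Module.Finite.iff_fg.1 hW)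
    · have : Submodule.map₂ b ⊤ W ≤ (Submodule.map₂ b ⊤ W).comap (act e) := by
        rw [Submodule.map₂_le]
        intro y _ w hw
        have h3 : act e (b y w) = b y (e • w) + b ⁅unbar e₀, y⁆ w := by
          change e • inc y • w = inc y • e • w + inc _ • w
          rw [← inc_lie, ← mul_smul, ← mul_smul, ← add_smul]
          congr 1
          change _ = _ + (e * _ - _ * e)
          abel
        rw [Submodule.mem_comap, h3]
        exact Submodule.add_mem _ (Submodule.apply_mem_map₂ b Submodule.mem_top (h2 w hw))
          (Submodule.apply_mem_map₂ b Submodule.mem_top hw)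
      intro w hw
      exact this hw
  | hadd u v hu hv => rw [add_smul]; exact (hu hm).add (hv hm)
  | hmul u v hu hv => rw [mul_smul]; exact hu (hv hm)

variable (M)

/-- The `U`-submodule of all elements of `M` on which `e` acts locally finitely. -/
def locallyFinitePart : Submodule U M where
  carrier := {m | IsLocallyFinite m}
  add_mem' := IsLocallyFinite.add
  zero_mem' := (isLocallyFinite_iff 0).2 ⟨⊥, inferInstance, by simp, by simp⟩
  smul_mem' u _ hm := IsLocallyFinite.smul hm u

/-- The Enright-Arkhipov completion of `M`: the `e`-locally finite part of `S_f ⊗_U M`. -/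
abbrev EnAr : Type := locallyFinitePart (Twist M)

end Completion

/-- The module `V(n, l)`, the completion of the Verma module `Δ(n - 2, l)`. -/
abbrev V (n : ℤ) (l : ℂ) : Type := EnAr (Verma ((n : ℂ) - 2) l)

end TakiffSl2

end

/-! `C` and `C̄` act by scalars on a Verma module, hence on its localization at `f`, on the
quotient, and on the locally finite part. On `Δ(l₁, l₂)` the scalars are `(l₁ + 2) l₂` and `l₂²`, so
all three modules of the theorem share the pair `(n λ₂, λ₂²)`. Their annihilators therefore contain
`U(C - n λ₂) + U(C̄ - λ₂²)`, and equality follows from two facts: the quotient of `U` by this ideal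
is simple when `λ₂ ≠ 0` (`mem_casimirIdeal_of_map_eq_zero`), and the modules are nonzero
(`nontrivial_V`).

Simplicity is proved in any quotient `A` of `U` in which `C̄` is regular; then `ē` is regular too
(`eb_regular`). Left multiplication by a power of `ē` moves any element into the algebra generated
by `C`, `C̄`, `ē`, `e`, `h̄`, `h`, because `f̄ē` and `ēfē` lie there. This algebra is a tower in
which `e`, `h̄`, `h` are adjoined in turn to `ℂ[C, C̄, ē]`. At each stage one of `[h̄, -]`, `[e,
-]`, `[ē, -]` kills the coefficients and sends the new variable to a nonzero multiple of `ē`;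
iterated as often as the degree, it leaves the leading coefficient times a power of `ē`. Thus a
nonzero ideal contains a nonzero polynomial in `ē` with central coefficients; `[h, -]` separates its
terms, and commutators with `f` replace `ē ^ i` by `C̄ ^ i`. So the ideal meets the image of `ℂ[C,
C̄]` (`exists_mem_algC_ker`), which in the central quotient consists of scalars.

The same descent shows that the centre of `A` is the image of `ℂ[C, C̄]` (`mem_algC_of_mem_center`).
Applied to the central quotient it gives the existence of `χ`; applied to `U` modulo `C̄`-torsion it
gives uniqueness, since `χ(C̄) ≠ 0`.

For `V(n, λ₂) ≠ 0`, take a vector `q` of weight `n - 2 - 2k` in the Verma module that is killed by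
`e`. For a suitable `N`, the fraction `f⁻ᴺ q` is again killed by `e`, and it is not in the image of
the Verma module because `q` has degree `k < N` in `f` and `f̄`. -/

noncomputable section

namespace TakiffSl2

/-! ### Iterated commutators in Ore extensions -/

section Ore

variable {A : Type*} [Ring A] [Algebra ℂ A]

/-- The inner derivation `[t, -]` of an associative algebra. -/
def innerDer (t : A) : Module.End ℂ A := LinearMap.mulLeft ℂ t - LinearMap.mulRight ℂ t

lemma inner_apply (t u : A) : innerDer t u = t * u - u * t := rfl

lemma inner_mul (t u v : A) : innerDer t (u * v) = innerDer t u * v + u * innerDer t v := by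
  simp only [inner_apply]; noncomm_ring

lemma inner_pow_mul_of_inner_eq_zero {t s : A} (hs : innerDer t s = 0) (k : ℕ) (y : A) :
    (innerDer t ^ k) (s * y) = s * (innerDer t ^ k) y := by
  induction k with
  | zero => rfl
  | succ k ih => simp only [pow_succ', Module.End.mul_apply, ih, inner_mul, hs, zero_mul, zero_add]

/-- Leibniz rule for `[t, -]^(k+1)`: since `[t, [t, x]] = 0`, at most one of the derivations can
fall on `x`. -/
lemma inner_pow_succ_mul {t x : A} (hx : innerDer t (innerDer t x) = 0) (k : ℕ) (y : A) :
    (innerDer t ^ (k + 1)) (x * y) =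
      x * (innerDer t ^ (k + 1)) y + ((k + 1 : ℕ) : ℂ) • (innerDer t x * (innerDer t ^ k) y) := by
  induction k with
  | zero => simp [inner_mul, add_comm]
  | succ k ih =>
    rw [pow_succ', Module.End.mul_apply, ih, map_add, map_smul, inner_mul, inner_mul, hx]
    simp only [pow_succ' (innerDer t), Module.End.mul_apply, zero_mul, zero_add]
    push_cast
    module

lemma inner_pow_pow {t x : A} (hx : innerDer t (innerDer t x) = 0) (m : ℕ) :
    (innerDer t ^ m) (x ^ m) = (m.factorial : ℂ) • innerDer t x ^ m ∧
      (innerDer t ^ (m + 1)) (x ^ m) = 0 := by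
  induction m with
  | zero => simp [inner_apply]
  | succ m ih =>
    constructor
    · rw [pow_succ' x, inner_pow_succ_mul hx, ih.1, ih.2, Nat.factorial_succ, pow_succ' (innerDer t x)]
      simp [mul_smul]
    · rw [pow_succ' x, inner_pow_succ_mul hx, ih.2, pow_succ' (innerDer t) (m + 1),
        Module.End.mul_apply, ih.2]
      simp

lemma inner_pow_pow_of_lt {t x : A} (hx : innerDer t (innerDer t x) = 0) {i m : ℕ} (h : i < m) :
    (innerDer t ^ m) (x ^ i) = 0 := by
  obtain ⟨k, rfl⟩ := Nat.exists_eq_add_of_lt h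
  rw [show i + k + 1 = k + (i + 1) by ring, pow_add, Module.End.mul_apply, (inner_pow_pow hx i).2,
    map_zero]

/-- The derivation `[t, -]`, applied `m` times, isolates the leading coefficient of a polynomial
of degree `m` in `x` if it is locally nilpotent of order two at `x` and kills the coefficients. -/
lemma inner_pow_eval {t x : A} (hx : innerDer t (innerDer t x) = 0) (p : Polynomial A)
    (hp : ∀ i, innerDer t (p.coeff i) = 0) :
    (innerDer t ^ p.natDegree) (p.eval x) =
      (p.natDegree.factorial : ℂ) • (p.leadingCoeff * innerDer t x ^ p.natDegree) := by
  rw [Polynomial.eval_eq_sum_range, map_sum, Finset.sum_range_succ, Finset.sum_eq_zero, zero_add,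
    inner_pow_mul_of_inner_eq_zero (hp _), (inner_pow_pow hx _).1, mul_smul_comm,
    Polynomial.leadingCoeff]
  intro i hi
  rw [inner_pow_mul_of_inner_eq_zero (hp _), inner_pow_pow_of_lt hx (Finset.mem_range.1 hi),
    mul_zero]

/-- The subalgebra generated by a subalgebra and one more element. -/
def adjoinElt (S : Subalgebra ℂ A) (x : A) : Subalgebra ℂ A := Algebra.adjoin ℂ (insert x (S : Set A))

lemma le_adjoinElt (S : Subalgebra ℂ A) (x : A) : S ≤ adjoinElt S x :=
  fun _ hs => Algebra.subset_adjoin (Set.mem_insert_of_mem _ hs)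

lemma self_mem_adjoinElt (S : Subalgebra ℂ A) (x : A) : x ∈ adjoinElt S x :=
  Algebra.subset_adjoin (Set.mem_insert _ _)

/-- If `[x, -]` maps `S` to `S'` and `x'` to `S'`, it maps `S[x']` to `S'`. -/
lemma inner_mem_of_mem_adjoinElt {S S' : Subalgebra ℂ A} {x x' : A} (hle : adjoinElt S x' ≤ S')
    (hS : ∀ s ∈ S, innerDer x s ∈ S') (hx : innerDer x x' ∈ S') :
    ∀ s ∈ adjoinElt S x', innerDer x s ∈ S' := by
  intro s hs
  induction hs using Algebra.adjoin_induction with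
  | mem y hy =>
    rcases hy with rfl | hy
    · exact hx
    · exact hS _ hy
  | algebraMap r => rw [inner_apply, Algebra.commutes, sub_self]; exact S'.zero_mem
  | add u v _ _ hu hv => rw [map_add]; exact S'.add_mem hu hv
  | mul u v hu' hv' hu hv =>
    rw [inner_mul]
    exact S'.add_mem (S'.mul_mem hu (hle hv')) (S'.mul_mem (hle hu') hv)

/-- If `[t, -]` kills `S` and `x`, it kills `S[x]`. -/
lemma inner_eq_zero_of_mem_adjoinElt {S : Subalgebra ℂ A} {t x : A}
    (hS : ∀ s ∈ S, innerDer t s = 0) (hx : innerDer t x = 0) : ∀ s ∈ adjoinElt S x, innerDer t s = 0 := by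
  intro s hs
  induction hs using Algebra.adjoin_induction with
  | mem y hy =>
    rcases hy with rfl | hy
    · exact hx
    · exact hS _ hy
  | algebraMap r => rw [inner_apply, Algebra.commutes, sub_self]
  | add u v _ _ hu hv => rw [map_add, hu, hv, add_zero]
  | mul u v _ _ hu hv => rw [inner_mul, hu, hv, zero_mul, mul_zero, add_zero]

/-- The elements of the Ore extension `S[x]` are polynomials in `x` with left coefficients. -/
lemma exists_eval_of_mem_adjoinElt {S : Subalgebra ℂ A} {x : A} (hS : ∀ s ∈ S, innerDer x s ∈ S)
    {u : A} (hu : u ∈ adjoinElt S x) :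
    ∃ p : Polynomial A, (∀ i, p.coeff i ∈ S) ∧ p.eval x = u := by
  -- The span of the ordered monomials is a left module over the whole extension; since it contains
  -- `1`, it contains every element. Moving `x` past a coefficient costs only `[x, s]`, which stays
  -- in `S`.
  set N : Submodule ℂ A := Submodule.span ℂ {y | ∃ s ∈ S, ∃ i : ℕ, s * x ^ i = y} with hN
  have hmul : ∀ a ∈ adjoinElt S x, ∀ y ∈ N, a * y ∈ N := by
    intro a ha
    induction ha using Algebra.adjoin_induction with
    | mem z hz =>
      intro y hy
      induction hy using Submodule.span_induction with
      | mem y hy =>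
        obtain ⟨s, hs, i, rfl⟩ := hy
        rcases hz with rfl | hz
        · have : z * (s * z ^ i) = innerDer z s * z ^ i + s * z ^ (i + 1) := by
            rw [inner_apply, pow_succ']; noncomm_ring
          rw [this]
          exact N.add_mem (Submodule.subset_span ⟨_, hS s hs, i, rfl⟩)
            (Submodule.subset_span ⟨s, hs, i + 1, rfl⟩)
        · rw [← mul_assoc]
          exact Submodule.subset_span ⟨_, S.mul_mem hz hs, i, rfl⟩
      | zero => rw [mul_zero]; exact N.zero_mem
      | add u v _ _ hu hv => rw [mul_add]; exact N.add_mem hu hv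
      | smul c u _ hu => rw [mul_smul_comm]; exact N.smul_mem c hu
    | algebraMap r => intro y hy; rw [← Algebra.smul_def]; exact N.smul_mem r hy
    | add u v _ _ hu hv => intro y hy; rw [add_mul]; exact N.add_mem (hu y hy) (hv y hy)
    | mul u v _ _ hu hv => intro y hy; rw [mul_assoc]; exact hu _ (hv y hy)
  have huN : u ∈ N := by
    have := hmul u hu 1 (Submodule.subset_span ⟨1, S.one_mem, 0, by simp⟩)
    rwa [mul_one] at this
  clear hu
  induction huN using Submodule.span_induction with
  | mem y hy =>
    obtain ⟨s, hs, i, rfl⟩ := hy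
    refine ⟨Polynomial.monomial i s, fun j => ?_, by simp⟩
    rw [Polynomial.coeff_monomial]
    split_ifs
    exacts [hs, S.zero_mem]
  | zero => exact ⟨0, by simp, by simp⟩
  | add u v _ _ hu hv =>
    obtain ⟨p, hp, rfl⟩ := hu
    obtain ⟨q, hq, rfl⟩ := hv
    exact ⟨p + q, fun i => by rw [Polynomial.coeff_add]; exact S.add_mem (hp i) (hq i), by simp⟩
  | smul c u _ hu =>
    obtain ⟨p, hp, rfl⟩ := hu
    exact ⟨c • p, fun i => by rw [Polynomial.coeff_smul]; exact S.smul_mem (hp i) c, by simp⟩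

/-! ### Extracting leading coefficients in one step of the tower -/

section Leading

variable {S : Subalgebra ℂ A} {t x τ : A} {c : ℂ}

lemma inner_pow_eval_eq_smul (hc : c ≠ 0) (htS : ∀ s ∈ S, innerDer t s = 0) (htx : innerDer t x = c • τ)
    (htτ : innerDer t τ = 0)
    (p : Polynomial A) (hp : ∀ i, p.coeff i ∈ S) :
    ∃ d : ℂ, d ≠ 0 ∧
      (innerDer t ^ p.natDegree) (p.eval x) = d • (p.leadingCoeff * τ ^ p.natDegree) := by
  refine ⟨p.natDegree.factorial * c ^ p.natDegree,
    mul_ne_zero (Nat.cast_ne_zero.2 (Nat.factorial_ne_zero _)) (pow_ne_zero _ hc), ?_⟩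
  rw [inner_pow_eval (by rw [htx, map_smul, htτ, smul_zero]) p fun i => htS _ (hp i), htx,
    smul_pow, mul_smul_comm, smul_smul]

/-- The centralizer of `t` in the Ore extension `S[x]` is `S`. -/
lemma mem_of_inner_eq_zero (hS : ∀ s ∈ S, innerDer x s ∈ S)
    (hc : c ≠ 0) (htS : ∀ s ∈ S, innerDer t s = 0) (htx : innerDer t x = c • τ)
    (htτ : innerDer t τ = 0)
    (hreg : ∀ m : ℕ, ∀ s ∈ S, s * τ ^ m = 0 → s = 0)
    {u : A} (hu : u ∈ adjoinElt S x) (htu : innerDer t u = 0) : u ∈ S := by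
  obtain ⟨p, hp, rfl⟩ := exists_eval_of_mem_adjoinElt hS hu
  obtain ⟨d, hd, h⟩ := inner_pow_eval_eq_smul hc htS htx htτ p hp
  rcases Nat.eq_zero_or_pos p.natDegree with h0 | h0
  · rw [Polynomial.eq_C_of_natDegree_eq_zero h0, Polynomial.eval_C]
    exact hp 0
  · obtain ⟨m, hm⟩ := Nat.exists_eq_succ_of_ne_zero h0.ne'
    -- If the degree is positive, the iterated derivation already vanishes on `u`, so the leading
    -- coefficient times a power of `τ` is zero.
    rw [hm, pow_succ, Module.End.mul_apply, htu, map_zero, eq_comm,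
      smul_eq_zero_iff_right hd] at h
    have := hreg _ _ (hp _) h
    rw [Polynomial.leadingCoeff_eq_zero.1 this]
    simp

/-- The kernel of a ring homomorphism meets `S` if it meets the Ore extension `S[x]`. -/
lemma exists_mem_ker_of_mem_adjoinElt (hS : ∀ s ∈ S, innerDer x s ∈ S)
    (hc : c ≠ 0) (htS : ∀ s ∈ S, innerDer t s = 0) (htx : innerDer t x = c • τ)
    (htτ : innerDer t τ = 0)
    (hreg : ∀ m : ℕ, ∀ s ∈ S, s * τ ^ m = 0 → s = 0)
    (hτS : τ ∈ S) {A' : Type*} [Ring A'] (ψ : A →+* A') {u : A}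
    (hu : u ∈ adjoinElt S x) (hu0 : u ≠ 0) (hψ : ψ u = 0) : ∃ s ∈ S, s ≠ 0 ∧ ψ s = 0 := by
  obtain ⟨p, hp, rfl⟩ := exists_eval_of_mem_adjoinElt hS hu
  obtain ⟨d, hd, h⟩ := inner_pow_eval_eq_smul hc htS htx htτ p hp
  refine ⟨(innerDer t ^ p.natDegree) (p.eval x), ?_, ?_, ?_⟩
  · rw [h]
    exact S.smul_mem (S.mul_mem (hp _) (S.pow_mem hτS _)) d
  · rw [h, Ne, smul_eq_zero_iff_right hd]
    intro h'
    have := hreg _ _ (hp _) h'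
    rw [Polynomial.leadingCoeff_eq_zero.1 this] at hu0
    simp at hu0
  · have key : ∀ k : ℕ, ψ ((innerDer t ^ k) (p.eval x)) = 0 := by
      intro k
      induction k with
      | zero => exact hψ
      | succ k ih => rw [pow_succ', Module.End.mul_apply, inner_apply, map_sub, map_mul, map_mul, ih,
          mul_zero, zero_mul, sub_zero]
    exact key _

end Leading

end Ore

/-! ### Quotients of `U` on which `C̄` is regular -/

/-- The commutator of `ē ^ (n+1)` with `f` trades one factor `ē` for `h̄`. Both the regularity of
`ē` and the passage from powers of `ē` to powers of `C̄` rest on it. -/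
lemma eb_pow_mul_f (n : ℕ) : eb ^ (n + 1) * f = f * eb ^ (n + 1) + (n + 1) * (hb * eb ^ n) := by
  induction n with
  | zero => simp [comm_f_eb]
  | succ n ih =>
    have h1 : eb * f = f * eb + hb := by rw [comm_f_eb, sub_add_cancel]
    have h2 : eb * ((n + 1) * (hb * eb ^ n)) = (n + 1) * (hb * eb ^ (n + 1)) := by
      rw [← Nat.cast_succ, ← (Nat.cast_commute _ eb).left_comm, assoc_of comm_eb_hb, mul_assoc,
        ← pow_succ']
    rw [pow_succ' eb (n + 1), mul_assoc, ih, mul_add, h2, ← mul_assoc, h1]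
    push_cast
    noncomm_ring

lemma eb_pow_mul_h (n : ℕ) : eb ^ n * h = h * eb ^ n - 2 * n * eb ^ n := by
  induction n with
  | zero => simp
  | succ n ih =>
    have h1 : eb * h = h * eb - 2 * eb := by rw [comm_h_eb, add_sub_cancel_right]
    have h2 : eb * (2 * n * eb ^ n) = 2 * n * eb ^ (n + 1) := by
      have : Commute eb (2 * (n : U)) := by
        rw [← Nat.cast_ofNat (R := U), ← Nat.cast_mul]; exact (Nat.cast_commute _ eb).symm
      rw [← mul_assoc, this.eq, mul_assoc, ← pow_succ']
    rw [pow_succ', mul_assoc, ih, mul_sub, h2, ← mul_assoc, h1, pow_succ']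
    push_cast
    simp only [sub_mul, mul_add, add_mul, mul_one, mul_assoc]
    abel

lemma eb_pow_mul_fb (n : ℕ) : eb ^ n * fb = fb * eb ^ n :=
  ((show Commute eb fb from comm_eb_fb).pow_left n).eq

lemma eb_pow_mul_e (n : ℕ) : eb ^ n * e = e * eb ^ n :=
  ((show Commute eb e from comm_e_eb.symm).pow_left n).eq

lemma eb_pow_mul_hb (n : ℕ) : eb ^ n * hb = hb * eb ^ n :=
  ((show Commute eb hb from comm_eb_hb).pow_left n).eq

section Filtration

variable {A : Type*} [Ring A] [Algebra ℂ A] (φ : U →ₐ[ℂ] A)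

/-- The subalgebra generated by the images of `C` and `C̄`. -/
def algC : Subalgebra ℂ A := Algebra.adjoin ℂ {φ casimir, φ casimirBar}
/-- The subalgebra generated by the images of `C`, `C̄` and `ē`. -/
def algEb : Subalgebra ℂ A := adjoinElt (algC φ) (φ eb)
/-- The subalgebra generated by the images of `C`, `C̄`, `ē` and `e`. -/
def algE : Subalgebra ℂ A := adjoinElt (algEb φ) (φ e)
/-- The subalgebra generated by the images of `C`, `C̄`, `ē`, `e` and `h̄`. -/
def algHb : Subalgebra ℂ A := adjoinElt (algE φ) (φ hb)
/-- The subalgebra generated by the images of `C`, `C̄`, `ē`, `e`, `h̄` and `h`. -/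
def algH : Subalgebra ℂ A := adjoinElt (algHb φ) (φ h)

lemma algC_le_algEb : algC φ ≤ algEb φ := le_adjoinElt _ _
lemma algEb_le_algE : algEb φ ≤ algE φ := le_adjoinElt _ _
lemma algE_le_algHb : algE φ ≤ algHb φ := le_adjoinElt _ _
lemma algHb_le_algH : algHb φ ≤ algH φ := le_adjoinElt _ _

lemma eb_mem : φ eb ∈ algEb φ := self_mem_adjoinElt _ _
lemma eb_mem_algE : φ eb ∈ algE φ := algEb_le_algE φ (eb_mem φ)
lemma eb_mem_algHb : φ eb ∈ algHb φ := algE_le_algHb φ (eb_mem_algE φ)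
lemma eb_mem_algH : φ eb ∈ algH φ := algHb_le_algH φ (eb_mem_algHb φ)
lemma e_mem : φ e ∈ algE φ := self_mem_adjoinElt _ _
lemma e_mem_algH : φ e ∈ algH φ := algHb_le_algH φ (algE_le_algHb φ (e_mem φ))
lemma hb_mem : φ hb ∈ algHb φ := self_mem_adjoinElt _ _
lemma hb_mem_algH : φ hb ∈ algH φ := algHb_le_algH φ (hb_mem φ)
lemma h_mem : φ h ∈ algH φ := self_mem_adjoinElt _ _

lemma algC_le_algH : algC φ ≤ algH φ := (algC_le_algEb φ).trans <| (algEb_le_algE φ).trans <|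
  (algE_le_algHb φ).trans (algHb_le_algH φ)

lemma casimir_mem_algC : φ casimir ∈ algC φ := Algebra.subset_adjoin (by simp)
lemma casimirBar_mem_algC : φ casimirBar ∈ algC φ := Algebra.subset_adjoin (by simp)

lemma smul_mem_cancel (S : Subalgebra ℂ A) {c : ℂ} (hc : c ≠ 0) {x : A} (hx : c • x ∈ S) :
    x ∈ S := by
  have := S.smul_mem hx c⁻¹
  rwa [smul_smul, inv_mul_cancel₀ hc, one_smul] at this

/-- The definition of `C̄` gives `4 f̄ē = C̄ - h̄²`. -/
lemma fb_eb_mem : φ (fb * eb) ∈ algH φ := by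
  refine smul_mem_cancel _ (c := 4) (by norm_num) ?_
  have : (4 : ℂ) • (fb * eb) = casimirBar - hb ^ 2 := by
    rw [casimirBar, add_sub_cancel_left, Algebra.smul_def, map_ofNat]
  rw [← map_smul, this, map_sub, map_pow]
  exact sub_mem (algC_le_algH φ (casimirBar_mem_algC φ)) (pow_mem (hb_mem_algH φ) 2)

/-- Multiply `C` by `ē` on the right: the term `2ēfē` is then expressed through `h̄hē` and `f̄ē·e`,
which are already available. -/
lemma eb_f_eb_mem : φ (eb * f * eb) ∈ algH φ := by
  refine smul_mem_cancel _ (c := 2) (by norm_num) ?_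
  have : (2 : ℂ) • (eb * f * eb) = casimir * eb - hb * h * eb - 2 * (fb * eb * e) := by
    rw [casimir, two_smul', mul_assoc fb, ← comm_e_eb]
    noncomm_ring
  rw [← map_smul, this, two_mul]
  simp only [map_sub, map_mul φ (fb * eb), map_add, map_mul φ _ eb, map_mul φ hb]
  have h1 := mul_mem (fb_eb_mem φ) (e_mem_algH φ)
  rw [map_mul φ fb] at h1
  exact sub_mem (sub_mem (mul_mem (algC_le_algH φ (casimir_mem_algC φ)) (eb_mem_algH φ))
    (mul_mem (mul_mem (hb_mem_algH φ) (h_mem φ)) (eb_mem_algH φ))) (add_mem h1 h1)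

/-- Every element is moved into the subalgebra generated by `C`, `C̄`, `ē`, `e`, `h̄`, `h` by a
power of `ē`. -/
lemma exists_eb_pow_mul_mem (u : U) : ∃ N : ℕ, φ eb ^ N * φ u ∈ algH φ := by
  -- Stated as a property of left multiplication by `φ u`, the claim passes to products, so it can
  -- be checked on generators.
  suffices H : ∀ w : A, (∃ N : ℕ, φ eb ^ N * w ∈ algH φ) → ∃ N : ℕ, φ eb ^ N * (φ u * w) ∈ algH φ by
    simpa using H 1 ⟨0, by simp⟩
  have mono : ∀ {w : A} {N M : ℕ}, N ≤ M → φ eb ^ N * w ∈ algH φ → φ eb ^ M * w ∈ algH φ := by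
    intro w N M hNM hw
    obtain ⟨k, rfl⟩ := Nat.exists_eq_add_of_le' hNM
    rw [pow_add, mul_assoc]
    exact mul_mem (pow_mem (eb_mem_algH φ) k) hw
  have rel : ∀ {a b : U} (w : A), a = b → φ a * w = φ b * w := fun w h => by rw [h]
  refine U_induction' (P := fun u => ∀ w : A, (∃ N : ℕ, φ eb ^ N * w ∈ algH φ) →
    ∃ N : ℕ, φ eb ^ N * (φ u * w) ∈ algH φ) ?_ ?_ ?_ ?_ ?_ ?_ ?_ ?_ ?_ u
  · rintro c w ⟨N, hN⟩
    refine ⟨N, ?_⟩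
    rw [AlgHom.commutes, ← Algebra.smul_def, mul_smul_comm]
    exact Subalgebra.smul_mem _ hN c
  · rintro w ⟨N, hN⟩
    refine ⟨N, ?_⟩
    have := rel w (eb_pow_mul_e N)
    simp only [map_mul, map_pow, mul_assoc] at this
    rw [this]
    exact mul_mem (e_mem_algH φ) hN
  · rintro w ⟨N, hN⟩
    refine ⟨N + 1 + 1, ?_⟩
    -- Two extra factors `ē` are needed for `f`, one on each side, to form `ēfē`; the commutator
    -- term is harmless.
    have h1 : eb ^ (N + 1 + 1) * f = eb * f * eb * eb ^ N + (N + 1 : ℕ) • (eb * hb * eb ^ N) := by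
      rw [pow_succ', mul_assoc, eb_pow_mul_f, pow_succ', nsmul_eq_mul, mul_add,
        ← Nat.cast_succ, ← (Nat.cast_commute _ eb).left_comm]
      simp only [mul_assoc]
    have := rel w h1
    rw [map_mul, map_pow, mul_assoc] at this
    rw [this]
    simp only [map_add, map_nsmul, map_mul φ _ (eb ^ N), map_pow, add_mul, smul_mul_assoc]
    rw [mul_assoc (φ (eb * f * eb)), mul_assoc (φ (eb * hb))]
    refine add_mem (mul_mem (eb_f_eb_mem φ) hN) (nsmul_mem (mul_mem ?_ hN) _)
    rw [map_mul]
    exact mul_mem (eb_mem_algH φ) (hb_mem_algH φ)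
  · rintro w ⟨N, hN⟩
    refine ⟨N, ?_⟩
    have h1 : eb ^ N * h = h * eb ^ N - (2 * N) • eb ^ N := by
      rw [eb_pow_mul_h, nsmul_eq_mul]; push_cast; rfl
    have := rel w h1
    simp only [map_mul, map_pow, map_sub, map_nsmul, sub_mul, smul_mul_assoc, mul_assoc] at this
    rw [this]
    exact sub_mem (mul_mem (h_mem φ) hN) (nsmul_mem hN _)
  · rintro w ⟨N, hN⟩
    refine ⟨N, ?_⟩
    rw [← mul_assoc, ← pow_succ, pow_succ', mul_assoc]
    exact mul_mem (eb_mem_algH φ) hN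
  · rintro w ⟨N, hN⟩
    refine ⟨N + 1, ?_⟩
    have := rel w (eb_pow_mul_fb (N + 1))
    rw [pow_succ' eb, ← mul_assoc fb, ← pow_succ', map_mul, map_mul, map_pow, map_pow, mul_assoc,
      mul_assoc] at this
    rw [this]
    exact mul_mem (fb_eb_mem φ) hN
  · rintro w ⟨N, hN⟩
    refine ⟨N, ?_⟩
    have := rel w (eb_pow_mul_hb N)
    simp only [map_mul, map_pow, mul_assoc] at this
    rw [this]
    exact mul_mem (hb_mem_algH φ) hN
  · intro u v hu hv w hw
    obtain ⟨N, hN⟩ := hu w hw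
    obtain ⟨M, hM⟩ := hv w hw
    refine ⟨max N M, ?_⟩
    rw [map_add, add_mul, mul_add]
    exact add_mem (mono (le_max_left _ _) hN) (mono (le_max_right _ _) hM)
  · intro u v hu hv w hw
    rw [map_mul, mul_assoc]
    exact hu _ (hv w hw)

variable {φ}

lemma inner_map (a b : U) : innerDer (φ a) (φ b) = φ (a * b - b * a) := by
  rw [inner_apply, map_sub, map_mul, map_mul]

lemma map_center_commute (hφ : Function.Surjective φ) {z : U} (hz : z ∈ Subalgebra.center ℂ U)
    (a : A) : a * φ z = φ z * a := by
  obtain ⟨u, rfl⟩ := hφ a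
  rw [← map_mul, Subalgebra.mem_center_iff.1 hz, map_mul]

lemma algC_le_center (hφ : Function.Surjective φ) : algC φ ≤ Subalgebra.center ℂ A := by
  refine Algebra.adjoin_le ?_
  rintro x (rfl | rfl)
  · exact Subalgebra.mem_center_iff.2 (map_center_commute hφ casimir_mem_center)
  · exact Subalgebra.mem_center_iff.2 (map_center_commute hφ casimirBar_mem_center)

lemma inner_algC (hφ : Function.Surjective φ) (t : A) : ∀ s ∈ algC φ, innerDer t s = 0 := by
  intro s hs
  rw [inner_apply, Subalgebra.mem_center_iff.1 (algC_le_center hφ hs), sub_self]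

lemma inner_eb_e : innerDer (φ eb) (φ e) = 0 := by rw [inner_map, comm_e_eb, sub_self, map_zero]
lemma inner_e_eb : innerDer (φ e) (φ eb) = 0 := by rw [inner_map, comm_e_eb, sub_self, map_zero]
lemma inner_eb_hb : innerDer (φ eb) (φ hb) = 0 := by rw [inner_map, comm_eb_hb, sub_self, map_zero]
lemma inner_hb_eb : innerDer (φ hb) (φ eb) = 0 := by rw [inner_map, comm_eb_hb, sub_self, map_zero]
lemma inner_h_hb : innerDer (φ h) (φ hb) = 0 := by rw [inner_map, comm_h_hb, sub_self, map_zero]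
lemma inner_self (a : A) : innerDer a a = 0 := by rw [inner_apply, sub_self]
lemma inner_h_eb : innerDer (φ h) (φ eb) = (2 : ℂ) • φ eb := by
  rw [inner_map, comm_h_eb, ← map_smul, two_smul', add_sub_cancel_left]
lemma inner_eb_h : innerDer (φ eb) (φ h) = (-2 : ℂ) • φ eb := by
  rw [inner_map, comm_h_eb, ← map_smul, neg_two_smul', sub_add_cancel_left]
lemma inner_h_e : innerDer (φ h) (φ e) = (2 : ℂ) • φ e := by
  rw [inner_map, comm_he, ← map_smul, two_smul', add_sub_cancel_left]
lemma inner_e_hb : innerDer (φ e) (φ hb) = (-2 : ℂ) • φ eb := by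
  rw [inner_map, comm_e_hb, ← map_smul, neg_two_smul']; congr 1; abel
lemma inner_hb_e : innerDer (φ hb) (φ e) = (2 : ℂ) • φ eb := by
  rw [inner_map, comm_e_hb, ← map_smul, two_smul']; congr 1; abel

/-! ### The tower of subalgebras when `C̄` is regular -/

section Regular

lemma inner_eb_algHb (hφ : Function.Surjective φ) : ∀ s ∈ algHb φ, innerDer (φ eb) s = 0 :=
  inner_eq_zero_of_mem_adjoinElt (inner_eq_zero_of_mem_adjoinElt
    (inner_eq_zero_of_mem_adjoinElt (inner_algC hφ _) (inner_self _)) inner_eb_e) inner_eb_hb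

lemma inner_e_algE (hφ : Function.Surjective φ) : ∀ s ∈ algE φ, innerDer (φ e) s = 0 :=
  inner_eq_zero_of_mem_adjoinElt
    (inner_eq_zero_of_mem_adjoinElt (inner_algC hφ _) inner_e_eb) (inner_self _)

lemma inner_hb_algEb (hφ : Function.Surjective φ) : ∀ s ∈ algEb φ, innerDer (φ hb) s = 0 :=
  inner_eq_zero_of_mem_adjoinElt (inner_algC hφ _) inner_hb_eb

lemma inner_h_algHb (hφ : Function.Surjective φ) : ∀ s ∈ algHb φ, innerDer (φ h) s ∈ algHb φ := by
  refine inner_mem_of_mem_adjoinElt le_rfl (inner_mem_of_mem_adjoinElt (algE_le_algHb φ)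
    (inner_mem_of_mem_adjoinElt ((algEb_le_algE φ).trans (algE_le_algHb φ))
    (fun s hs => ?_) ?_) ?_) ?_
  · rw [inner_algC hφ _ s hs]; exact zero_mem _
  · rw [inner_h_eb]; exact Subalgebra.smul_mem _ (eb_mem_algHb φ) _
  · rw [inner_h_e]; exact Subalgebra.smul_mem _ (algE_le_algHb φ (e_mem φ)) _
  · rw [inner_h_hb]; exact zero_mem _

lemma inner_hb_algE (hφ : Function.Surjective φ) : ∀ s ∈ algE φ, innerDer (φ hb) s ∈ algE φ := by
  refine inner_mem_of_mem_adjoinElt le_rfl (fun s hs => ?_) ?_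
  · rw [inner_hb_algEb hφ s hs]; exact zero_mem _
  · rw [inner_hb_e]; exact Subalgebra.smul_mem _ (eb_mem_algE φ) _

lemma inner_e_algEb (hφ : Function.Surjective φ) : ∀ s ∈ algEb φ, innerDer (φ e) s ∈ algEb φ := by
  intro s hs
  rw [inner_e_algE hφ s (algEb_le_algE φ hs)]
  exact zero_mem _

lemma casimirBar_mul_eq_zero {w : A} (h1 : φ eb * w = 0) (h2 : φ hb * w = 0) :
    φ casimirBar * w = 0 := by
  have : φ casimirBar * w = φ hb * (φ hb * w) + 4 * (φ fb * (φ eb * w)) := by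
    simp only [casimirBar, map_add, map_mul, map_pow, map_ofNat]
    noncomm_ring
  rw [this, h1, h2]; simp

/-- If `C̄` is regular, so is `ē`. -/
lemma eb_regular (hφ : Function.Surjective φ) (hreg : ∀ x : A, φ casimirBar * x = 0 → x = 0)
    {x : A} (hx : φ eb * x = 0) : x = 0 := by
  have hf : ∀ n : ℕ, φ eb ^ (n + 1) * φ f = φ f * φ eb ^ (n + 1) + (n + 1) * (φ hb * φ eb ^ n) := by
    intro n
    have := congrArg φ (eb_pow_mul_f n)
    simpa using this
  have step : ∀ (n : ℕ) (y : A), φ eb ^ (n + 1) * innerDer (φ f) y =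
      φ f * (φ eb ^ (n + 1) * y) - φ eb ^ (n + 1) * y * φ f +
        (n + 1) * (φ hb * (φ eb ^ n * y)) := by
    intro n y
    have : φ eb ^ (n + 1) * (φ f * y) =
        (φ f * φ eb ^ (n + 1) + (n + 1) * (φ hb * φ eb ^ n)) * y := by rw [← hf, mul_assoc]
    rw [inner_apply, mul_sub, this]
    noncomm_ring
  -- Descent on `N`. If `ē ^ (N+1)` kills both `y` and `[f, y]`, then `w = ē ^ N y` is killed by `ē`
  -- and by `h̄`, hence by `C̄`, so `w = 0`.
  have key : ∀ (N : ℕ) (x : A), (∀ j : ℕ, φ eb ^ N * (innerDer (φ f) ^ j) x = 0) → x = 0 := by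
    intro N
    induction N with
    | zero => intro x hx; simpa using hx 0
    | succ N ih =>
      intro x hx
      refine ih x fun j => ?_
      have h1 := step N ((innerDer (φ f) ^ j) x)
      rw [← Module.End.mul_apply, ← pow_succ', hx, hx] at h1
      have h2 : φ hb * (φ eb ^ N * (innerDer (φ f) ^ j) x) = 0 := by
        simp only [mul_zero, zero_mul, sub_zero, zero_add] at h1
        have h3 : ((N + 1 : ℕ) : ℂ) • (φ hb * (φ eb ^ N * (innerDer (φ f) ^ j) x)) = 0 := by
          rw [Algebra.smul_def, map_natCast, h1]; push_cast; rfl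
        exact (smul_eq_zero_iff_right (Nat.cast_ne_zero.2 N.succ_ne_zero)).1 h3
      refine hreg _ (casimirBar_mul_eq_zero ?_ h2)
      rw [← mul_assoc, ← pow_succ', hx]
  -- Each commutator with `f` costs one more power of `ē`.
  have hpow : ∀ j : ℕ, φ eb ^ (j + 1) * (innerDer (φ f) ^ j) x = 0 := by
    intro j
    induction j with
    | zero => simpa using hx
    | succ j ih =>
      rw [pow_succ' (innerDer (φ f)), Module.End.mul_apply, step, ih, pow_succ' (φ eb) (j + 1),
        mul_assoc (φ eb), ih]
      simp
  obtain ⟨u, rfl⟩ := hφ x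
  have hiter : ∀ j : ℕ, (innerDer (φ f) ^ j) (φ u) = φ (adf^[j] u) := by
    intro j
    induction j with
    | zero => rfl
    | succ j ih => rw [pow_succ', Module.End.mul_apply, ih, inner_map, Function.iterate_succ_apply',
        adf]
  -- Local nilpotence of `[f, -]` leaves finitely many nonzero iterates, so a single power of `ē`
  -- kills all of them.
  obtain ⟨k, hk⟩ := adf_nilpotent u
  refine key k _ fun j => ?_
  rcases le_or_gt k j with hkj | hkj
  · obtain ⟨i, rfl⟩ := Nat.exists_eq_add_of_le' hkj
    rw [hiter, Function.iterate_add_apply, hk, adf_iter_zero, map_zero, mul_zero]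
  · obtain ⟨i, rfl⟩ := Nat.exists_eq_add_of_le' hkj
    rw [pow_add, mul_assoc, Nat.succ_eq_add_one, hpow, mul_zero]

lemma eb_pow_regular (hφ : Function.Surjective φ)
    (hreg : ∀ x : A, φ casimirBar * x = 0 → x = 0) (N : ℕ) {x : A} (hx : φ eb ^ N * x = 0) :
    x = 0 := by
  induction N with
  | zero => simpa using hx
  | succ N ih =>
    rw [pow_succ', mul_assoc] at hx
    exact ih (eb_regular hφ hreg hx)

/-- Regularity was shown for left multiplication only; an element commuting with `ē` lets the power
change sides. -/
lemma eb_pow_regular_right (hφ : Function.Surjective φ)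
    (hreg : ∀ x : A, φ casimirBar * x = 0 → x = 0) (m : ℕ) {x : A} (hc : innerDer (φ eb) x = 0)
    (hx : x * φ eb ^ m = 0) : x = 0 := by
  rw [((show Commute (φ eb) x from sub_eq_zero.1 hc).pow_left m).eq.symm] at hx
  exact eb_pow_regular hφ hreg m hx

/-- Central combinations of powers of `ē` are separated by the action of `h`. -/
lemma map_coeff_mul_eb_pow_eq_zero {A' : Type*} [Ring A'] [Algebra ℂ A'] (ψ : A →ₐ[ℂ] A') (m : ℕ)
    (d : ℕ → A) (hd : ∀ i, innerDer (φ h) (d i) = 0)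
    (hψ : ψ (∑ i ∈ Finset.range m, d i * φ eb ^ i) = 0) : ∀ i < m, ψ (d i * φ eb ^ i) = 0 := by
  have heig : ∀ i : ℕ, innerDer (φ h) (φ eb ^ i) = (2 * i : ℂ) • φ eb ^ i := by
    intro i
    induction i with
    | zero => simp [inner_apply]
    | succ i ih =>
      rw [pow_succ', inner_mul, ih, inner_h_eb, smul_mul_assoc, mul_smul_comm, ← add_smul]
      congr 1
      push_cast
      ring
  induction m generalizing d with
  | zero => intro i hi; omega
  | succ m ih =>
    have h0 : ψ (innerDer (φ h) (∑ i ∈ Finset.range (m + 1), d i * φ eb ^ i)) = 0 := by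
      rw [inner_apply, map_sub, map_mul, map_mul, hψ, mul_zero, zero_mul, sub_zero]
    -- `ē ^ i` is an eigenvector of `[h, -]` with eigenvalue `2i`. Subtracting `2m` removes the top
    -- term and multiplies the others by the nonzero numbers `2i - 2m`.
    have h1 : innerDer (φ h) (∑ i ∈ Finset.range (m + 1), d i * φ eb ^ i) -
        (2 * m : ℂ) • ∑ i ∈ Finset.range (m + 1), d i * φ eb ^ i =
          ∑ i ∈ Finset.range m, ((2 * i - 2 * m : ℂ) • d i) * φ eb ^ i := by
      rw [map_sum, Finset.smul_sum, ← Finset.sum_sub_distrib, Finset.sum_range_succ,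
        inner_mul, hd, heig, zero_mul, zero_add, mul_smul_comm, sub_self, add_zero]
      refine Finset.sum_congr rfl fun i _ => ?_
      rw [inner_mul, hd, heig, zero_mul, zero_add, mul_smul_comm, ← sub_smul, smul_mul_assoc]
    have h2 := congrArg ψ h1
    rw [map_sub, map_smul, h0, hψ, smul_zero, sub_zero, eq_comm] at h2
    have h3 := ih _ (fun i => by rw [map_smul, hd, smul_zero]) h2
    have h4 : ∀ i < m, ψ (d i * φ eb ^ i) = 0 := by
      intro i hi
      have := h3 i hi
      rw [smul_mul_assoc, map_smul] at this
      refine (smul_eq_zero_iff_right ?_).1 this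
      rw [← mul_sub]
      exact mul_ne_zero two_ne_zero (sub_ne_zero.2 (Nat.cast_injective.ne hi.ne))
    intro i hi
    rcases Nat.lt_succ_iff_lt_or_eq.1 hi with hi | rfl
    · exact h4 i hi
    · rw [Finset.sum_range_succ, map_add, map_sum,
        Finset.sum_eq_zero fun j hj => h4 j (Finset.mem_range.1 hj), zero_add] at hψ
      exact hψ

lemma exists_sum_of_mem_algEb (hφ : Function.Surjective φ) {u : A} (hu : u ∈ algEb φ) :
    ∃ (m : ℕ) (d : ℕ → A), (∀ i, d i ∈ algC φ) ∧ u = ∑ i ∈ Finset.range m, d i * φ eb ^ i := by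
  obtain ⟨p, hp, rfl⟩ := exists_eval_of_mem_adjoinElt
    (fun s hs => by rw [inner_algC hφ _ s hs]; exact zero_mem _) hu
  exact ⟨_, p.coeff, hp, Polynomial.eval_eq_sum_range _⟩

/-- If `C̄` is regular, the centre is generated by `C` and `C̄`. -/
lemma mem_algC_of_mem_center (hφ : Function.Surjective φ)
    (hreg : ∀ x : A, φ casimirBar * x = 0 → x = 0) {z : A} (hz : z ∈ Subalgebra.center ℂ A) :
    z ∈ algC φ := by
  have hz' : ∀ t, innerDer t z = 0 := fun t => by
    rw [inner_apply, Subalgebra.mem_center_iff.1 hz, sub_self]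
  have hreg' : ∀ m : ℕ, ∀ s ∈ algHb φ, s * φ eb ^ m = 0 → s = 0 := fun m s hs hsm =>
    eb_pow_regular_right hφ hreg m (inner_eb_algHb hφ s hs) hsm
  obtain ⟨u, rfl⟩ := hφ z
  obtain ⟨N, hN⟩ := exists_eb_pow_mul_mem φ u
  have hcomm : ∀ t, innerDer t (φ eb) = 0 → innerDer t (φ eb ^ N * φ u) = 0 := by
    intro t ht
    have : innerDer t (φ eb ^ N) = 0 :=
      sub_eq_zero.2 ((show Commute t (φ eb) from sub_eq_zero.1 ht).pow_right N).eq
    rw [inner_mul, this, hz', zero_mul, mul_zero, add_zero]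
  -- `ē ^ N z` commutes with `ē`, `e` and `h̄`, so it descends the tower past `h`, `h̄` and `e` in
  -- turn.
  have h3 := mem_of_inner_eq_zero (inner_h_algHb hφ) (c := -2) (by norm_num) (inner_eb_algHb hφ)
    inner_eb_h (inner_self _) hreg' hN (hcomm _ (inner_self _))
  have h2 := mem_of_inner_eq_zero (inner_hb_algE hφ) (c := -2) (by norm_num) (inner_e_algE hφ)
    inner_e_hb inner_e_eb (fun m s hs => hreg' m s (algE_le_algHb φ hs)) h3 (hcomm _ inner_e_eb)
  have h1 := mem_of_inner_eq_zero (inner_e_algEb hφ) (c := 2) (by norm_num) (inner_hb_algEb hφ)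
    inner_hb_e inner_hb_eb (fun m s hs => hreg' m s (algE_le_algHb φ (algEb_le_algE φ hs))) h2
    (hcomm _ inner_hb_eb)
  obtain ⟨m, d, hd, hsum⟩ := exists_sum_of_mem_algEb hφ h1
  -- From `ē ^ N z = ∑ d i * ē ^ i` with `z` central, subtract `z ē ^ N` from the sum. By separation
  -- of weights the coefficient of `ē ^ N` must vanish, so `z` is `d N`, or zero if that term is
  -- absent.
  let d' : ℕ → A := fun i => (if i < m then d i else 0) - if i = N then φ u else 0
  have hd' : ∀ t i, innerDer t (d' i) = 0 := by
    intro t i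
    simp only [d']
    rw [map_sub]
    split_ifs <;> simp [hz', inner_algC hφ t _ (hd i)]
  have hsum' : ∑ i ∈ Finset.range (max m (N + 1)), d' i * φ eb ^ i = 0 := by
    simp only [d', sub_mul, Finset.sum_sub_distrib, ite_mul, zero_mul]
    rw [Finset.sum_ite_eq', if_pos (by simp), ← Finset.sum_filter]
    have : (Finset.range (max m (N + 1))).filter (· < m) = Finset.range m := by
      ext i; simp; omega
    rw [this, ← hsum, Subalgebra.mem_center_iff.1 hz, sub_self]
  have h0 := map_coeff_mul_eb_pow_eq_zero (AlgHom.id ℂ A) _ d' (hd' _) (by simpa using hsum') N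
    (by simp)
  have h0' := eb_pow_regular_right hφ hreg N (hd' _ N) h0
  simp only [d', if_true] at h0'
  rw [← sub_eq_zero.1 h0']
  split_ifs
  exacts [hd N, zero_mem _]

/-- With `b` central, the commutator of `b ē ^ (i+1)` with `f` shows that `b h̄ ē ^ i` is in the
kernel. Hence so is `b C̄ ē ^ i`, a combination of these two elements, and the induction continues
with `b C̄` in place of `b`. -/
lemma map_mul_casimirBar_pow (hφ : Function.Surjective φ) {A' : Type*} [Ring A'] [Algebra ℂ A']
    (ψ : A →ₐ[ℂ] A') (i : ℕ) {b : A} (hbC : b ∈ algC φ) (hψ : ψ (b * φ eb ^ i) = 0) :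
    ψ (b * φ casimirBar ^ i) = 0 := by
  induction i generalizing b with
  | zero => simpa using hψ
  | succ i ih =>
    have hc : ∀ a, a * b = b * a := Subalgebra.mem_center_iff.1 (algC_le_center hφ hbC)
    have h1 : ((i + 1 : ℕ) : ℂ) • (b * (φ hb * φ eb ^ i)) =
        b * φ eb ^ (i + 1) * φ f - φ f * (b * φ eb ^ (i + 1)) := by
      have := congrArg φ (eb_pow_mul_f i)
      simp only [map_mul, map_pow, map_add, map_natCast, map_one] at this
      rw [mul_assoc, this, ← mul_assoc (φ f), hc, Algebra.smul_def, map_natCast,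
        (Nat.cast_commute (i + 1) b).left_comm]
      push_cast
      noncomm_ring
    have h2 := congrArg ψ h1
    rw [map_sub, map_mul ψ _ (φ f), map_mul ψ (φ f), hψ, zero_mul, mul_zero, sub_zero, map_smul,
      smul_eq_zero_iff_right (Nat.cast_ne_zero.2 i.succ_ne_zero)] at h2
    have h3 : b * φ casimirBar * φ eb ^ i =
        φ hb * (b * (φ hb * φ eb ^ i)) + 4 * (φ fb * (b * φ eb ^ (i + 1))) := by
      rw [← mul_assoc (φ hb) b, ← mul_assoc (φ fb) b, hc, hc]
      simp only [casimirBar, map_add, map_mul, map_pow, map_ofNat]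
      have : (4 : A) * (b * φ fb * φ eb ^ (i + 1)) = b * (4 * (φ fb * φ eb)) * φ eb ^ i := by
        rw [pow_succ']; noncomm_ring
      rw [this]
      noncomm_ring
    rw [pow_succ', ← mul_assoc]
    refine ih (mul_mem hbC (casimirBar_mem_algC φ)) ?_
    rw [h3, map_add, map_mul ψ (φ hb), h2, map_mul, map_mul ψ (φ fb), hψ]
    simp

/-- If `C̄` is regular, every nonzero ideal contains a nonzero polynomial in `C` and `C̄`. -/
lemma exists_mem_algC_ker (hφ : Function.Surjective φ)
    (hreg : ∀ x : A, φ casimirBar * x = 0 → x = 0) {A' : Type*} [Ring A'] [Algebra ℂ A']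
    (ψ : A →ₐ[ℂ] A') {x : A} (hx : x ≠ 0) (hψ : ψ x = 0) : ∃ d ∈ algC φ, d ≠ 0 ∧ ψ d = 0 := by
  have hreg' : ∀ m : ℕ, ∀ s ∈ algHb φ, s * φ eb ^ m = 0 → s = 0 := fun m s hs hsm =>
    eb_pow_regular_right hφ hreg m (inner_eb_algHb hφ s hs) hsm
  obtain ⟨u, rfl⟩ := hφ x
  obtain ⟨N, hN⟩ := exists_eb_pow_mul_mem φ u
  have h40 : φ eb ^ N * φ u ≠ 0 := fun h0 => hx (eb_pow_regular hφ hreg N h0)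
  -- Iterated commutators stay in the kernel, so a nonzero kernel element survives each step down
  -- the tower, losing `h`, then `h̄`, then `e`.
  obtain ⟨s₃, h3, h30, h3ψ⟩ := exists_mem_ker_of_mem_adjoinElt (inner_h_algHb hφ) (c := -2)
    (by norm_num) (inner_eb_algHb hφ) inner_eb_h (inner_self _) hreg' (eb_mem_algHb φ) ψ.toRingHom
    hN h40 (by rw [map_mul]; exact mul_eq_zero_of_right _ hψ)
  obtain ⟨s₂, h2, h20, h2ψ⟩ := exists_mem_ker_of_mem_adjoinElt (inner_hb_algE hφ) (c := -2)
    (by norm_num) (inner_e_algE hφ) inner_e_hb inner_e_eb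
    (fun m s hs => hreg' m s (algE_le_algHb φ hs)) (eb_mem_algE φ) ψ.toRingHom h3 h30 h3ψ
  obtain ⟨s₁, h1, h10, h1ψ⟩ := exists_mem_ker_of_mem_adjoinElt (inner_e_algEb hφ) (c := 2)
    (by norm_num) (inner_hb_algEb hφ) inner_hb_e inner_hb_eb
    (fun m s hs => hreg' m s (algE_le_algHb φ (algEb_le_algE φ hs))) (eb_mem φ) ψ.toRingHom
    h2 h20 h2ψ
  obtain ⟨m, d, hd, rfl⟩ := exists_sum_of_mem_algEb hφ h1
  have hall := map_coeff_mul_eb_pow_eq_zero ψ m d (fun i => inner_algC hφ _ _ (hd i)) h1ψ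
  have hne : ∀ (i : ℕ) (b : A), b ≠ 0 → b * φ casimirBar ^ i ≠ 0 := by
    intro i b hb
    induction i with
    | zero => simpa using hb
    | succ i ih =>
      rw [pow_succ, ← mul_assoc]
      exact fun h0 => ih (hreg _ (by rw [← h0, map_center_commute hφ casimirBar_mem_center]))
  obtain ⟨i, hi, hi0⟩ := Finset.exists_ne_zero_of_sum_ne_zero h10
  have hdi : d i ≠ 0 := fun h0 => hi0 (by rw [h0, zero_mul])
  have hdi' := hall i (Finset.mem_range.1 hi)
  exact ⟨_, mul_mem (hd i) (pow_mem (casimirBar_mem_algC φ) i), hne i _ hdi,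
    map_mul_casimirBar_pow hφ ψ i (hd i) hdi'⟩

end Regular
end Filtration

/-! ### Central quotients of `U` -/

/-- The left ideal `U(C - a) + U(C̄ - b)`. -/
def casimirIdeal (a b : ℂ) : Ideal U :=
  Ideal.span {casimir - algebraMap ℂ U a, casimirBar - algebraMap ℂ U b}

lemma casimir_sub_mem (a b : ℂ) : casimir - algebraMap ℂ U a ∈ casimirIdeal a b :=
  Ideal.subset_span (by simp)

lemma casimirBar_sub_mem (a b : ℂ) : casimirBar - algebraMap ℂ U b ∈ casimirIdeal a b :=
  Ideal.subset_span (by simp)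

instance (a b : ℂ) : (casimirIdeal a b).IsTwoSided where
  mul_mem_of_left {x} y hx := by
    induction hx using Submodule.span_induction with
    | mem x hx =>
      have hz : x ∈ Subalgebra.center ℂ U := by
        rcases hx with rfl | rfl
        · exact sub_mem casimir_mem_center (Subalgebra.algebraMap_mem _ a)
        · exact sub_mem casimirBar_mem_center (Subalgebra.algebraMap_mem _ b)
      rw [← Subalgebra.mem_center_iff.1 hz]
      exact Ideal.mul_mem_left _ _ (Ideal.subset_span hx)
    | zero => rw [zero_mul]; exact zero_mem _
    | add u v _ _ hu hv => rw [add_mul]; exact add_mem hu hv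
    | smul r u _ hu => rw [smul_eq_mul, mul_assoc]; exact Ideal.mul_mem_left _ _ hu

/-- The quotient map onto `U / (U(C - a) + U(C̄ - b))`. -/
abbrev toQuot (a b : ℂ) : U →ₐ[ℂ] U ⧸ casimirIdeal a b := Ideal.Quotient.mkₐ ℂ (casimirIdeal a b)

lemma toQuot_eq_zero {a b : ℂ} {u : U} : toQuot a b u = 0 ↔ u ∈ casimirIdeal a b :=
  Ideal.Quotient.eq_zero_iff_mem

lemma toQuot_surjective (a b : ℂ) : Function.Surjective (toQuot a b) :=
  Ideal.Quotient.mk_surjective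

lemma toQuot_casimir (a b : ℂ) : toQuot a b casimir = algebraMap ℂ _ a := by
  have := toQuot_eq_zero.2 (casimir_sub_mem a b)
  rwa [map_sub, AlgHom.commutes, sub_eq_zero] at this

lemma toQuot_casimirBar (a b : ℂ) : toQuot a b casimirBar = algebraMap ℂ _ b := by
  have := toQuot_eq_zero.2 (casimirBar_sub_mem a b)
  rwa [map_sub, AlgHom.commutes, sub_eq_zero] at this

lemma algC_toQuot_le (a b : ℂ) : algC (toQuot a b) ≤ ⊥ := by
  refine Algebra.adjoin_le ?_
  rintro x (rfl | rfl)
  · rw [toQuot_casimir]; exact Subalgebra.algebraMap_mem _ a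
  · rw [toQuot_casimirBar]; exact Subalgebra.algebraMap_mem _ b

lemma toQuot_regular (a : ℂ) {b : ℂ} (hb : b ≠ 0) (x : U ⧸ casimirIdeal a b)
    (hx : toQuot a b casimirBar * x = 0) : x = 0 := by
  rw [toQuot_casimirBar, ← Algebra.smul_def] at hx
  exact (smul_eq_zero_iff_right hb).1 hx

/-- For `b ≠ 0`, the algebra `U / (U(C - a) + U(C̄ - b))` is simple. -/
lemma mem_casimirIdeal_of_map_eq_zero {a b : ℂ} (hb : b ≠ 0) {A' : Type*} [Ring A'] [Algebra ℂ A']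
    [Nontrivial A'] (ψ : U →ₐ[ℂ] A') (hC : ψ casimir = algebraMap ℂ A' a)
    (hCbar : ψ casimirBar = algebraMap ℂ A' b) {u : U} (hu : ψ u = 0) : u ∈ casimirIdeal a b := by
  by_contra hmem
  have hle : ∀ v ∈ casimirIdeal a b, ψ v = 0 := by
    intro v hv
    have : casimirIdeal a b ≤ RingHom.ker ψ := by
      refine Ideal.span_le.2 ?_
      rintro x (rfl | rfl) <;> simp [RingHom.mem_ker, hC, hCbar]
    exact this hv
  obtain ⟨d, hd, hd0, hψd⟩ := exists_mem_algC_ker (toQuot_surjective a b) (toQuot_regular a hb)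
    (Ideal.Quotient.liftₐ _ ψ hle) (x := toQuot a b u) (fun h0 => hmem (toQuot_eq_zero.1 h0)) hu
  -- `C` and `C̄` are scalars in the quotient, so the kernel contains a nonzero scalar; this is
  -- impossible as the target is nontrivial.
  obtain ⟨c, rfl⟩ := Algebra.mem_bot.1 (algC_toQuot_le a b hd)
  rw [AlgHom.commutes, FaithfulSMul.algebraMap_eq_zero_iff] at hψd
  exact hd0 (by rw [hψd, map_zero])

/-- One inclusion is the hypothesis on `C` and `C̄`; the other applies simplicity of the central
quotient to the representation of `U` on `M`, which is where `M ≠ 0` enters. -/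
lemma annihilator_eq_casimirIdeal {a b : ℂ} (hb : b ≠ 0) (M : Type*) [AddCommGroup M] [Module ℂ M]
    [Module U M] [IsScalarTower ℂ U M] [Nontrivial M] (hC : ∀ m : M, casimir • m = a • m)
    (hCbar : ∀ m : M, casimirBar • m = b • m) : Module.annihilator U M = casimirIdeal a b := by
  apply le_antisymm
  · intro u hu
    refine mem_casimirIdeal_of_map_eq_zero hb (Algebra.lsmul ℂ ℂ M) ?_ ?_ ?_
    · ext m; simpa using hC m
    · ext m; simpa using hCbar m
    · ext m; simpa using Module.mem_annihilator.1 hu m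
  · refine Ideal.span_le.2 ?_
    rintro x (rfl | rfl) <;> refine Module.mem_annihilator.2 fun m => ?_
    · rw [sub_smul, hC, algebraMap_smul, sub_self]
    · rw [sub_smul, hCbar, algebraMap_smul, sub_self]

/-! ### Central characters -/

lemma toQuot_mem_bot (a : ℂ) {b : ℂ} (hb : b ≠ 0) (z : Z) : toQuot a b z ∈ (⊥ : Subalgebra ℂ _) :=
  algC_toQuot_le a b (mem_algC_of_mem_center (toQuot_surjective a b) (toQuot_regular a hb)
    (Subalgebra.mem_center_iff.2 (map_center_commute (toQuot_surjective a b) z.2)))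

lemma exists_character (a : ℂ) {b : ℂ} (hb : b ≠ 0) [Nontrivial (U ⧸ casimirIdeal a b)] :
    ∃ χ : Z →ₐ[ℂ] ℂ, χ C = a ∧ χ Cbar = b ∧ idealOfKer χ = casimirIdeal a b := by
  have hinj : Function.Injective (algebraMap ℂ (U ⧸ casimirIdeal a b)) :=
    FaithfulSMul.algebraMap_injective _ _
  -- The centre of `U` lands in the scalars of the quotient; `χ` reads off the scalar.
  let χ : Z →ₐ[ℂ] ℂ := (Algebra.botEquivOfInjective hinj).toAlgHom.comp
    (((toQuot a b).comp Z.val).codRestrict ⊥ (toQuot_mem_bot a hb))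
  have hχ : ∀ (z : Z) (c : ℂ), χ z = c ↔ toQuot a b z = algebraMap ℂ _ c := by
    intro z c
    have h1 : χ z = c ↔ ((toQuot a b).comp Z.val).codRestrict ⊥ (toQuot_mem_bot a hb) z =
        algebraMap ℂ _ c := by
      rw [← (Algebra.botEquivOfInjective hinj).injective.eq_iff, AlgEquiv.commutes]
      rfl
    rw [h1, Subtype.ext_iff]
    rfl
  have hCa : χ C = a := (hχ _ _).2 (toQuot_casimir a b)
  have hCb : χ Cbar = b := (hχ _ _).2 (toQuot_casimirBar a b)
  refine ⟨χ, hCa, hCb, le_antisymm ?_ ?_⟩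
  · refine Ideal.span_le.2 ?_
    rintro _ ⟨z, hz, rfl⟩
    refine toQuot_eq_zero.1 ?_
    rw [(hχ z 0).1 hz, map_zero]
  · refine Ideal.span_le.2 ?_
    rintro x (rfl | rfl)
    · exact Ideal.subset_span ⟨C - algebraMap ℂ Z a, by simp [hCa], rfl⟩
    · exact Ideal.subset_span ⟨Cbar - algebraMap ℂ Z b, by simp [hCb], rfl⟩

lemma casimirBar_pow_commute (k : ℕ) (u : U) : u * casimirBar ^ k = casimirBar ^ k * u :=
  Subalgebra.mem_center_iff.1 (pow_mem casimirBar_mem_center k) u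

/-- The ideal of elements annihilated by a power of `C̄`. -/
def casimirBarTorsion : Ideal U where
  carrier := {u | ∃ k : ℕ, casimirBar ^ k * u = 0}
  zero_mem' := ⟨0, by simp⟩
  add_mem' := by
    rintro u v ⟨k, hk⟩ ⟨l, hl⟩
    refine ⟨k + l, ?_⟩
    rw [mul_add, pow_add, mul_assoc _ _ v, hl, ← casimirBar_pow_commute, mul_assoc, hk]
    simp
  smul_mem' := by
    rintro r u ⟨k, hk⟩
    exact ⟨k, by rw [smul_eq_mul, ← mul_assoc, ← casimirBar_pow_commute, mul_assoc, hk, mul_zero]⟩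

instance : casimirBarTorsion.IsTwoSided where
  mul_mem_of_left y := by
    rintro ⟨k, hk⟩
    exact ⟨k, by rw [← mul_assoc, hk, zero_mul]⟩

/-- Up to `C̄`-torsion, the centre is generated by `C` and `C̄`. -/
lemma exists_pow_mul_eq (z : Z) : ∃ w ∈ Algebra.adjoin ℂ {C, Cbar}, ∃ k : ℕ,
    Cbar ^ k * z = Cbar ^ k * w := by
  let φ : U →ₐ[ℂ] U ⧸ casimirBarTorsion := Ideal.Quotient.mkₐ ℂ casimirBarTorsion
  have hφ : Function.Surjective φ := Ideal.Quotient.mk_surjective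
  have h0 : ∀ u, φ u = 0 ↔ ∃ k : ℕ, casimirBar ^ k * u = 0 := fun u =>
    Ideal.Quotient.eq_zero_iff_mem
  -- Dividing by the `C̄`-torsion forces `C̄` to be regular, so no domain property of `U` is needed.
  have hreg : ∀ x, φ casimirBar * x = 0 → x = 0 := by
    intro x hx
    obtain ⟨u, rfl⟩ := hφ x
    rw [← map_mul, h0] at hx
    obtain ⟨k, hk⟩ := hx
    exact (h0 u).2 ⟨k + 1, by rw [pow_succ, mul_assoc, hk]⟩
  have hz := mem_algC_of_mem_center hφ hreg
    (Subalgebra.mem_center_iff.2 (map_center_commute hφ z.2))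
  have : algC φ = (Algebra.adjoin ℂ {C, Cbar}).map (φ.comp Z.val) := by
    rw [AlgHom.map_adjoin, Set.image_pair]
    rfl
  rw [this] at hz
  obtain ⟨w, hw, hwz⟩ := hz
  refine ⟨w, hw, ?_⟩
  have h1 : φ (z - w) = 0 := by rw [map_sub, sub_eq_zero]; exact hwz.symm
  obtain ⟨k, hk⟩ := (h0 _).1 h1
  refine ⟨k, Subtype.ext ?_⟩
  rw [mul_sub, sub_eq_zero] at hk
  exact hk

/-- A character with nonzero value at `C̄` cannot see `C̄`-torsion, so it is determined on `ℂ[C,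
C̄]`. -/
lemma character_ext {χ χ' : Z →ₐ[ℂ] ℂ} (h : χ Cbar ≠ 0) (hC : χ C = χ' C)
    (hCbar : χ Cbar = χ' Cbar) : χ = χ' := by
  ext z
  obtain ⟨w, hw, k, hk⟩ := exists_pow_mul_eq z
  have hval : ∀ η : Z →ₐ[ℂ] ℂ, η Cbar ≠ 0 → η z = η w := by
    intro η hη
    have := congrArg η hk
    rw [map_mul, map_mul, map_pow] at this
    exact mul_left_cancel₀ (pow_ne_zero k hη) this
  rw [hval χ h, hval χ' (hCbar ▸ h)]
  have : Algebra.adjoin ℂ {C, Cbar} ≤ AlgHom.equalizer χ χ' := by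
    refine Algebra.adjoin_le ?_
    rintro x (rfl | rfl)
    exacts [hC, hCbar]
  exact this hw

/-! ### Representations of `U` by generators and relations -/

lemma sl2_trace (v : Sl2) : v.1 1 1 = -v.1 0 0 := by
  have := v.2
  have h : v.1 0 0 + v.1 1 1 = 0 := by simpa [sl, Matrix.trace_fin_two] using this
  linear_combination h

/-- The linear map on `sl₂` with prescribed values on the standard basis. -/
def comb {A : Type*} [AddCommGroup A] [Module ℂ A] (E F H : A) : Sl2 →ₗ[ℂ] A where
  toFun v := v.1 0 1 • E + v.1 1 0 • F + v.1 0 0 • H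
  map_add' v w := by
    change (v.1 0 1 + w.1 0 1) • E + (v.1 1 0 + w.1 1 0) • F + (v.1 0 0 + w.1 0 0) • H = _
    module
  map_smul' c v := by
    change (c * v.1 0 1) • E + (c * v.1 1 0) • F + (c * v.1 0 0) • H = c • _
    module

lemma comb_apply {A : Type*} [AddCommGroup A] [Module ℂ A] (E F H : A) (v : Sl2) :
    comb E F H v = v.1 0 1 • E + v.1 1 0 • F + v.1 0 0 • H := rfl

lemma comb_lie {A : Type*} [AddCommGroup A] [Module ℂ A] (E F H : A) (v w : Sl2) :
    comb E F H ⁅v, w⁆ = (2 * (v.1 0 0 * w.1 0 1 - v.1 0 1 * w.1 0 0)) • E +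
      (2 * (v.1 1 0 * w.1 0 0 - v.1 0 0 * w.1 1 0)) • F +
      (v.1 0 1 * w.1 1 0 - v.1 1 0 * w.1 0 1) • H := by
  rw [comb_apply, LieAlgebra.SpecialLinear.sl_bracket]
  simp only [Matrix.sub_apply, Matrix.mul_apply, Fin.sum_univ_two, sl2_trace]
  congr 1
  · congr 1 <;> congr 1 <;> ring
  · congr 1; ring

attribute [local instance 100] LieRing.ofAssociativeRing in
/-- The universal property of `U` in terms of the standard generators. -/
lemma exists_algHom {A : Type*} [Ring A] [Algebra ℂ A] {E F H Eb Fb Hb : A}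
    (ef : E * F = F * E + H) (he : H * E = E * H + (2 : ℂ) • E)
    (hf : H * F = F * H - (2 : ℂ) • F) (e_eb : E * Eb = Eb * E) (f_fb : F * Fb = Fb * F)
    (h_hb : H * Hb = Hb * H) (e_fb : E * Fb = Fb * E + Hb) (f_eb : F * Eb = Eb * F - Hb)
    (h_eb : H * Eb = Eb * H + (2 : ℂ) • Eb) (h_fb : H * Fb = Fb * H - (2 : ℂ) • Fb)
    (e_hb : E * Hb = Hb * E - (2 : ℂ) • Eb) (f_hb : F * Hb = Hb * F + (2 : ℂ) • Fb)
    (eb_fb : Eb * Fb = Fb * Eb) (eb_hb : Eb * Hb = Hb * Eb) (hb_fb : Hb * Fb = Fb * Hb) :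
    ∃ φ : U →ₐ[ℂ] A, φ e = E ∧ φ f = F ∧ φ h = H ∧ φ eb = Eb ∧ φ fb = Fb ∧ φ hb = Hb := by
  let L : DualNumber ℂ ⊗[ℂ] Sl2 →ₗ[ℂ] A := TensorProduct.lift <|
    LinearMap.mk₂ ℂ (fun a v => a.fst • comb E F H v + a.snd • comb Eb Fb Hb v)
      (fun a b v => by simp only [TrivSqZeroExt.fst_add, TrivSqZeroExt.snd_add]; module)
      (fun c a v => by
        simp only [TrivSqZeroExt.fst_smul, TrivSqZeroExt.snd_smul, smul_eq_mul]; module)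
      (fun a v w => by simp only [map_add]; module)
      (fun c a v => by simp only [map_smul]; module)
  let g : T →ₗ[ℂ] A := L
  have g_unbar : ∀ v, g (unbar v) = comb E F H v := by
    intro v
    change L ((1 : DualNumber ℂ) ⊗ₜ[ℂ] v) = _
    simp [L]
  have g_bar : ∀ v, g (bar v) = comb Eb Fb Hb v := by
    intro v
    change L ((DualNumber.eps : DualNumber ℂ) ⊗ₜ[ℂ] v) = _
    simp [L]
  have uu : ∀ v w, g ⁅unbar v, unbar w⁆ = g (unbar v) * g (unbar w) - g (unbar w) * g (unbar v) := by
    intro v w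
    rw [lie_unbar_unbar, g_unbar, g_unbar, g_unbar, comb_lie, comb_apply, comb_apply]
    simp only [mul_add, add_mul, smul_mul_assoc, mul_smul_comm, ef, he, hf]
    module
  have ub : ∀ v w, g ⁅unbar v, bar w⁆ = g (unbar v) * g (bar w) - g (bar w) * g (unbar v) := by
    intro v w
    rw [lie_unbar_bar, g_unbar, g_bar, g_bar, comb_lie, comb_apply, comb_apply]
    simp only [mul_add, add_mul, smul_mul_assoc, mul_smul_comm, e_eb, f_fb, h_hb, e_fb, f_eb, h_eb,
      h_fb, e_hb, f_hb]
    module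
  have bb : ∀ v w, g ⁅bar v, bar w⁆ = g (bar v) * g (bar w) - g (bar w) * g (bar v) := by
    intro v w
    rw [lie_bar_bar, map_zero, g_bar, g_bar, comb_apply, comb_apply]
    simp only [mul_add, add_mul, smul_mul_assoc, mul_smul_comm, eb_fb, eb_hb, hb_fb]
    module
  let G : T →ₗ⁅ℂ⁆ A :=
    { g with
      map_lie' := by
        intro x y
        change g ⁅x, y⁆ = g x * g y - g y * g x
        obtain ⟨v, w, rfl⟩ := exists_eq x
        obtain ⟨v', w', rfl⟩ := exists_eq y
        have bu : g ⁅bar w, unbar v'⁆ =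
            g (bar w) * g (unbar v') - g (unbar v') * g (bar w) := by
          rw [← lie_skew, map_neg, ub, neg_sub]
        simp only [lie_add, add_lie, map_add, uu, ub, bu, bb]
        noncomm_ring }
  refine ⟨UniversalEnvelopingAlgebra.lift ℂ G, ?_⟩
  have hu : ∀ v, UniversalEnvelopingAlgebra.lift ℂ G (inc (unbar v)) = comb E F H v := fun v =>
    (UniversalEnvelopingAlgebra.lift_ι_apply ℂ G (unbar v)).trans (g_unbar v)
  have hb' : ∀ v, UniversalEnvelopingAlgebra.lift ℂ G (inc (bar v)) = comb Eb Fb Hb v := fun v =>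
    (UniversalEnvelopingAlgebra.lift_ι_apply ℂ G (bar v)).trans (g_bar v)
  refine ⟨(hu _).trans ?_, (hu _).trans ?_, (hu _).trans ?_, (hb' _).trans ?_, (hb' _).trans ?_,
    (hb' _).trans ?_⟩ <;> simp [comb_apply, e₀, f₀, h₀]

/-! ### A model containing the Verma module -/

section Model

variable (l₁ l₂ : ℂ)

/-- The space of formal series `∑ a i j • x ^ i * y ^ j`. The operators below realize the Verma
module on the polynomials in `x` and `y`, with `f̄` and `f` acting as `x` and `y`. -/
abbrev Series : Type := ℤ → ℤ → ℂ

/-- Read off from the action of `e` on `f̄ ^ i f ^ j v`: the coefficient at `(i, j)` collects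
contributions from `(i, j + 1)` and `(i + 1, j)`. Indexing by all integers makes the shifts total
and the relations polynomial identities. -/
def opE : Module.End ℂ Series where
  toFun a i j := (j + 1) * (l₁ - j - 2 * i) * a i (j + 1) + l₂ * (i + 1) * a (i + 1) j
  map_add' a b := by ext i j; simp only [Pi.add_apply]; ring
  map_smul' c a := by ext i j; simp only [Pi.smul_apply, smul_eq_mul, RingHom.id_apply]; ring

def opF : Module.End ℂ Series where
  toFun a i j := a i (j - 1)
  map_add' _ _ := rfl
  map_smul' _ _ := rfl

def opH : Module.End ℂ Series where
  toFun a i j := (l₁ - 2 * i - 2 * j) * a i j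
  map_add' a b := by ext i j; simp only [Pi.add_apply]; ring
  map_smul' c a := by ext i j; simp only [Pi.smul_apply, smul_eq_mul, RingHom.id_apply]; ring

def opEb : Module.End ℂ Series where
  toFun a i j := l₂ * (j + 1) * a i (j + 1) - (j + 2) * (j + 1) * a (i - 1) (j + 2)
  map_add' a b := by ext i j; simp only [Pi.add_apply]; ring
  map_smul' c a := by ext i j; simp only [Pi.smul_apply, smul_eq_mul, RingHom.id_apply]; ring

def opFb : Module.End ℂ Series where
  toFun a i j := a (i - 1) j
  map_add' _ _ := rfl
  map_smul' _ _ := rfl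

def opHb : Module.End ℂ Series where
  toFun a i j := l₂ * a i j - 2 * (j + 1) * a (i - 1) (j + 1)
  map_add' a b := by ext i j; simp only [Pi.add_apply]; ring
  map_smul' c a := by ext i j; simp only [Pi.smul_apply, smul_eq_mul, RingHom.id_apply]; ring

lemma exists_model : ∃ φ : U →ₐ[ℂ] Module.End ℂ Series, φ e = opE l₁ l₂ ∧ φ f = opF ∧
    φ h = opH l₁ ∧ φ eb = opEb l₂ ∧ φ fb = opFb ∧ φ hb = opHb l₂ := by
  apply exists_algHom <;> ext a i j <;>
    simp only [opE, opF, opH, opEb, opFb, opHb, Module.End.mul_apply, LinearMap.coe_mk,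
      AddHom.coe_mk, LinearMap.add_apply, LinearMap.sub_apply, LinearMap.smul_apply, Pi.add_apply,
      Pi.sub_apply, Pi.smul_apply, smul_eq_mul, Int.cast_add,
      Int.cast_sub, Int.cast_one, Int.cast_ofNat] <;> ring_nf

/-- The highest weight vector of the model. -/
def delta : Series := fun i j => if i = 0 ∧ j = 0 then 1 else 0

/-- The map `u ↦ u v`, where `v` is the highest weight vector of the model. -/
lemma exists_verma_model : ∃ g : U →ₗ[ℂ] Series, (∀ u ∈ vermaIdeal l₁ l₂, g u = 0) ∧ g 1 = delta ∧
    (∀ u i j, g (f * u) i j = g u i (j - 1)) ∧ (∀ u i j, g (fb * u) i j = g u (i - 1) j) ∧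
    ∀ u i j, j < 0 → g u i j = 0 := by
  obtain ⟨φ, he, hf, hh, heb, hfb, hhb⟩ := exists_model l₁ l₂
  refine ⟨φ.toLinearMap.flip delta, ?_, by simp, ?_, ?_, ?_⟩
  · intro u hu
    simp only [LinearMap.flip_apply, AlgHom.toLinearMap_apply]
    induction hu using Submodule.span_induction with
    | mem x hx =>
      rcases hx with rfl | rfl | rfl | rfl
      · rw [he]
        ext i j
        simp only [opE, delta, LinearMap.coe_mk, AddHom.coe_mk, Pi.zero_apply]
        split_ifs with h1 h2 h2
        · omega
        · obtain ⟨rfl, hj⟩ := h1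
          rw [show j = -1 by omega]; simp
        · obtain ⟨hi, rfl⟩ := h2
          rw [show i = -1 by omega]; simp
        · simp
      · rw [heb]
        ext i j
        simp only [opEb, delta, LinearMap.coe_mk, AddHom.coe_mk, Pi.zero_apply]
        split_ifs with h1 h2 h2
        · omega
        · obtain ⟨rfl, hj⟩ := h1
          rw [show j = -1 by omega]; simp
        · obtain ⟨hi, hj⟩ := h2
          rw [show j = -2 by omega]; simp
        · simp
      · rw [map_sub, hh, AlgHom.commutes]
        ext i j
        simp only [opH, delta, LinearMap.coe_mk, AddHom.coe_mk, Pi.zero_apply, LinearMap.sub_apply,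
          Module.algebraMap_end_apply, Pi.sub_apply, Pi.smul_apply]
        split_ifs with h1
        · obtain ⟨rfl, rfl⟩ := h1; simp
        · simp
      · rw [map_sub, hhb, AlgHom.commutes]
        ext i j
        simp only [opHb, delta, LinearMap.coe_mk, AddHom.coe_mk, Pi.zero_apply, LinearMap.sub_apply,
          Module.algebraMap_end_apply, Pi.sub_apply, Pi.smul_apply]
        split_ifs with h1 h2 h2
        · omega
        · simp
        · obtain ⟨hi, hj⟩ := h2
          rw [show j = -1 by omega]; simp
        · simp
    | zero => simp
    | add u v _ _ hu hv => rw [map_add, LinearMap.add_apply, hu, hv, add_zero]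
    | smul r u _ hu => rw [smul_eq_mul, map_mul, Module.End.mul_apply, hu, map_zero]
  · intro u i j; simp [hf, opF]
  · intro u i j; simp [hfb, opFb]
  · intro u
    -- Only `e`, `ē` and `h̄` could lower the `y`-degree below zero, and there the factors `j + 1`
    -- and `(j + 2)(j + 1)` vanish.
    have hsupp : ∀ (u : U) (a : Series), (∀ i j, j < 0 → a i j = 0) →
        ∀ i j, j < 0 → φ u a i j = 0 := by
      intro u
      refine U_induction' (P := fun u => ∀ a : Series, (∀ i j, j < 0 → a i j = 0) →
        ∀ i j, j < 0 → φ u a i j = 0) ?_ ?_ ?_ ?_ ?_ ?_ ?_ ?_ ?_ u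
      · intro c a ha i j hj
        rw [AlgHom.commutes, Module.algebraMap_end_apply, Pi.smul_apply, Pi.smul_apply, ha i j hj,
          smul_zero]
      · intro a ha i j hj
        rw [he]
        simp only [opE, LinearMap.coe_mk, AddHom.coe_mk]
        rw [ha (i + 1) j hj]
        rcases (show j = -1 ∨ j + 1 < 0 by omega) with rfl | hj'
        · simp
        · rw [ha _ _ hj']; simp
      · intro a ha i j hj
        rw [hf]
        exact ha _ _ (by omega)
      · intro a ha i j hj
        rw [hh]
        simp only [opH, LinearMap.coe_mk, AddHom.coe_mk]
        rw [ha i j hj, mul_zero]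
      · intro a ha i j hj
        rw [heb]
        simp only [opEb, LinearMap.coe_mk, AddHom.coe_mk]
        rcases (show j = -1 ∨ j = -2 ∨ j + 2 < 0 by omega) with rfl | rfl | hj'
        · simp
        · rw [ha i _ (by norm_num)]; simp
        · rw [ha i _ (by omega), ha _ _ hj']; simp
      · intro a ha i j hj
        rw [hfb]
        exact ha _ _ hj
      · intro a ha i j hj
        rw [hhb]
        simp only [opHb, LinearMap.coe_mk, AddHom.coe_mk]
        rw [ha i j hj]
        rcases (show j = -1 ∨ j + 1 < 0 by omega) with rfl | hj'
        · simp
        · rw [ha _ _ hj']; simp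
      · intro u v hu hv a ha i j hj
        rw [map_add, LinearMap.add_apply, Pi.add_apply, Pi.add_apply, hu a ha i j hj,
          hv a ha i j hj, add_zero]
      · intro u v hu hv a ha
        rw [map_mul, Module.End.mul_apply]
        exact hu _ (hv a ha)
    refine hsupp u delta fun i j hj => ?_
    rw [delta, if_neg (by omega)]

end Model

/-! ### Highest weight vectors -/

section HighestWeight

variable {M : Type*} [AddCommGroup M] [Module ℂ M] [Module U M] [IsScalarTower ℂ U M]

lemma two_smul_smul (u : U) (m : M) : (2 * u) • m = (2 : ℂ) • u • m := by
  rw [← two_smul', smul_assoc]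

lemma h_smul_f (m : M) : h • f • m = f • h • m - (2 : ℂ) • f • m := by
  rw [← mul_smul, comm_hf, sub_smul, two_smul_smul, mul_smul]

lemma h_smul_fb (m : M) : h • fb • m = fb • h • m - (2 : ℂ) • fb • m := by
  rw [← mul_smul, comm_h_fb, sub_smul, two_smul_smul, mul_smul]

lemma e_smul_f (m : M) : e • f • m = f • e • m + h • m := by
  rw [← mul_smul, comm_ef, add_smul, mul_smul]

lemma e_smul_fb (m : M) : e • fb • m = fb • e • m + hb • m := by
  rw [← mul_smul, comm_e_fb, add_smul, mul_smul]

lemma hb_smul_f (m : M) : hb • f • m = f • hb • m - (2 : ℂ) • fb • m := by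
  have : hb * f = f * hb - 2 * fb := by rw [comm_f_hb, add_sub_cancel_right]
  rw [← mul_smul, this, sub_smul, two_smul_smul, mul_smul]

lemma e_smul_fb_pow (i : ℕ) (m : M) :
    e • fb ^ i • m = fb ^ i • e • m + (i : ℂ) • fb ^ (i - 1) • hb • m := by
  induction i with
  | zero => simp
  | succ i ih =>
    have hcomm : hb • fb ^ i • m = fb ^ i • hb • m := by
      rw [← mul_smul, ((show Commute hb fb from comm_hb_fb).pow_right i).eq, mul_smul]
    have hlast : fb • (i : ℂ) • fb ^ (i - 1) • hb • m = (i : ℂ) • fb ^ i • hb • m := by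
      rcases Nat.eq_zero_or_pos i with rfl | hi
      · simp
      · rw [smul_comm, ← mul_smul fb, ← pow_succ', Nat.sub_add_cancel hi]
    rw [pow_succ', mul_smul, mul_smul, e_smul_fb, ih, smul_add, hlast, hcomm, Nat.add_sub_cancel]
    push_cast
    rw [add_smul, one_smul, add_assoc]

variable {l₁ l₂ : ℂ} {v : M}

lemma h_smul_f_pow (hh : h • v = l₁ • v) (j : ℕ) :
    h • f ^ j • v = (l₁ - 2 * j) • f ^ j • v := by
  induction j with
  | zero => simp [hh]
  | succ j ih =>
    rw [pow_succ', mul_smul, h_smul_f, ih, smul_comm f, ← sub_smul]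
    push_cast
    congr 1
    ring

lemma h_smul_fb_pow_f_pow (hh : h • v = l₁ • v) (i j : ℕ) :
    h • fb ^ i • f ^ j • v = (l₁ - 2 * i - 2 * j) • fb ^ i • f ^ j • v := by
  induction i with
  | zero => simp [h_smul_f_pow hh]
  | succ i ih =>
    rw [pow_succ', mul_smul, h_smul_fb, ih, smul_comm fb, ← sub_smul]
    push_cast
    congr 1
    ring

lemma e_smul_f_pow (he : e • v = 0) (hh : h • v = l₁ • v) (j : ℕ) :
    e • f ^ j • v = (j * (l₁ + 1 - j)) • f ^ (j - 1) • v := by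
  induction j with
  | zero => simp [he]
  | succ j ih =>
    have hlast : f • ((j : ℂ) * (l₁ + 1 - j)) • f ^ (j - 1) • v =
        ((j : ℂ) * (l₁ + 1 - j)) • f ^ j • v := by
      rcases Nat.eq_zero_or_pos j with rfl | hj
      · simp
      · rw [smul_comm, ← mul_smul f, ← pow_succ', Nat.sub_add_cancel hj]
    rw [pow_succ', mul_smul, e_smul_f, ih, hlast, h_smul_f_pow hh, Nat.add_sub_cancel, ← add_smul]
    push_cast
    congr 1
    ring

lemma hb_smul_f_pow (hhb : hb • v = l₂ • v) (j : ℕ) :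
    hb • f ^ j • v = l₂ • f ^ j • v - (2 * j : ℂ) • fb • f ^ (j - 1) • v := by
  induction j with
  | zero => simp [hhb]
  | succ j ih =>
    have hlast : f • (2 * j : ℂ) • fb • f ^ (j - 1) • v = (2 * j : ℂ) • fb • f ^ j • v := by
      rcases Nat.eq_zero_or_pos j with rfl | hj
      · simp
      · rw [smul_comm f, ← mul_smul f, comm_f_fb, mul_smul fb, ← mul_smul f, ← pow_succ',
          Nat.sub_add_cancel hj]
    rw [pow_succ', mul_smul, hb_smul_f, ih, smul_sub, hlast, smul_comm f, Nat.add_sub_cancel,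
      sub_sub, ← add_smul]
    push_cast
    congr 2
    ring

/-- Commuting `e` past `f̄ ^ i` produces `h̄`, whose action on `f ^ j v` returns a further `f̄`;
this accounts for the summand `-2i`. The truncated exponents are harmless, as their coefficients
vanish at `0`. -/
lemma e_smul_fb_pow_f_pow (he : e • v = 0) (hh : h • v = l₁ • v) (hhb : hb • v = l₂ • v)
    (i j : ℕ) : e • fb ^ i • f ^ j • v =
      (j * (l₁ + 1 - j - 2 * i)) • fb ^ i • f ^ (j - 1) • v +
        (l₂ * i) • fb ^ (i - 1) • f ^ j • v := by
  have hlast : (i : ℂ) • fb ^ (i - 1) • fb • f ^ (j - 1) • v =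
      (i : ℂ) • fb ^ i • f ^ (j - 1) • v := by
    rcases Nat.eq_zero_or_pos i with rfl | hi
    · simp
    · rw [← mul_smul (fb ^ (i - 1)), ← pow_succ, Nat.sub_add_cancel hi]
  rw [e_smul_fb_pow, e_smul_f_pow he hh, hb_smul_f_pow hhb, smul_sub, smul_sub,
    smul_comm (fb ^ (i - 1)) l₂, smul_comm (fb ^ (i - 1)) (2 * j : ℂ), smul_comm _ (2 * j : ℂ),
    hlast, smul_comm (fb ^ i)]
  generalize fb ^ i • f ^ (j - 1) • v = x, fb ^ (i - 1) • f ^ j • v = y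
  module

/-- The coefficients of a singular vector. -/
def singularCoeff (l₁ l₂ : ℂ) (k : ℕ) : ℕ → ℂ
  | 0 => 1
  | i + 1 => -((k - i) * (l₁ + 1 - k - i) * singularCoeff l₁ l₂ k i) / (l₂ * (i + 1))

/-- An element of `U` mapping highest weight vectors of weight `l₁` to singular vectors of weight
`l₁ - 2k`. -/
def singularElt (l₁ l₂ : ℂ) (k : ℕ) : U :=
  ∑ i ∈ Finset.range (k + 1), singularCoeff l₁ l₂ k i • (fb ^ i * f ^ (k - i))

lemma singularElt_smul (k : ℕ) : singularElt l₁ l₂ k • v =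
    ∑ i ∈ Finset.range (k + 1), singularCoeff l₁ l₂ k i • fb ^ i • f ^ (k - i) • v := by
  rw [singularElt, Finset.sum_smul]
  exact Finset.sum_congr rfl fun i _ => by rw [smul_assoc, mul_smul]

lemma h_smul_singularElt (hh : h • v = l₁ • v) (k : ℕ) :
    h • singularElt l₁ l₂ k • v = (l₁ - 2 * k) • singularElt l₁ l₂ k • v := by
  rw [singularElt_smul, Finset.smul_sum, Finset.smul_sum]
  refine Finset.sum_congr rfl fun i hi => ?_
  have hi' : i ≤ k := Nat.lt_succ_iff.1 (Finset.mem_range.1 hi)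
  rw [smul_comm h, h_smul_fb_pow_f_pow hh, smul_comm, Nat.cast_sub hi']
  congr 1
  ring

lemma e_smul_singularElt (hl₂ : l₂ ≠ 0) (he : e • v = 0) (hh : h • v = l₁ • v)
    (hhb : hb • v = l₂ • v) (k : ℕ) : e • singularElt l₁ l₂ k • v = 0 := by
  -- The recursion for `singularCoeff` makes the sum telescope: the `h̄`-contribution of term `m +
  -- 1` cancels what is left from the terms up to `m`. At `m = k` the factor `k - m` vanishes.
  have key : ∀ m ≤ k, e • ∑ i ∈ Finset.range (m + 1),
      singularCoeff l₁ l₂ k i • fb ^ i • f ^ (k - i) • v =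
        ((k - m) * (l₁ + 1 - k - m) * singularCoeff l₁ l₂ k m) •
          fb ^ m • f ^ (k - m - 1) • v := by
    intro m
    induction m with
    | zero =>
      intro _
      simp only [zero_add, Finset.sum_range_one]
      rw [smul_comm, e_smul_fb_pow_f_pow he hh hhb, smul_add, smul_smul, smul_smul]
      simp [singularCoeff]
    | succ m ih =>
      intro hm
      have hc : singularCoeff l₁ l₂ k (m + 1) * (l₂ * (m + 1)) =
          -((k - m) * (l₁ + 1 - k - m) * singularCoeff l₁ l₂ k m) := by
        rw [singularCoeff]
        exact div_mul_cancel₀ _ (mul_ne_zero hl₂ (Nat.cast_add_one_ne_zero m))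
      rw [Finset.sum_range_succ, smul_add, ih (by omega), smul_comm e,
        e_smul_fb_pow_f_pow he hh hhb, Nat.add_sub_cancel, smul_add, smul_smul _ (l₂ * _),
        Nat.cast_sub hm, ← Nat.sub_sub k m 1]
      push_cast
      rw [hc]
      generalize fb ^ m • f ^ (k - m - 1) • v = x, fb ^ (m + 1) • f ^ (k - m - 1 - 1) • v = y
      module
  rw [singularElt_smul, key k le_rfl]
  simp

lemma casimir_smul (he : e • v = 0) (heb : eb • v = 0) (hh : h • v = l₁ • v)
    (hhb : hb • v = l₂ • v) : casimir • v = ((l₁ + 2) * l₂) • v := by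
  have h1 : eb * f = f * eb + hb := by rw [comm_f_eb, sub_add_cancel]
  rw [casimir, h1, add_smul, add_smul, two_smul_smul, two_smul_smul]
  simp only [add_smul, mul_smul, he, heb, hh, hhb, smul_zero, smul_comm hb l₁]
  module

lemma casimirBar_smul (heb : eb • v = 0) (hhb : hb • v = l₂ • v) :
    casimirBar • v = l₂ ^ 2 • v := by
  rw [casimirBar, pow_two]
  simp only [add_smul, mul_smul, heb, hhb, smul_zero, smul_comm hb l₂]
  module

end HighestWeight

/-! ### Verma modules -/

section Verma

variable (l₁ l₂ : ℂ)

/-- The highest weight vector of the Verma module. -/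
def vermaVec : Verma l₁ l₂ := Submodule.Quotient.mk 1

variable {l₁ l₂}

lemma smul_vermaVec (u : U) : u • vermaVec l₁ l₂ = Submodule.Quotient.mk u := by
  rw [vermaVec, ← Submodule.Quotient.mk_smul, smul_eq_mul, mul_one]

lemma smul_vermaVec_eq_zero {u : U} : u • vermaVec l₁ l₂ = 0 ↔ u ∈ vermaIdeal l₁ l₂ := by
  rw [smul_vermaVec, Submodule.Quotient.mk_eq_zero]

lemma exists_smul_vermaVec (m : Verma l₁ l₂) : ∃ u : U, m = u • vermaVec l₁ l₂ := by
  obtain ⟨u, rfl⟩ := Submodule.Quotient.mk_surjective _ m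
  exact ⟨u, (smul_vermaVec u).symm⟩

lemma e_vermaVec : e • vermaVec l₁ l₂ = 0 :=
  smul_vermaVec_eq_zero.2 (Submodule.subset_span (by simp))

lemma eb_vermaVec : eb • vermaVec l₁ l₂ = 0 :=
  smul_vermaVec_eq_zero.2 (Submodule.subset_span (by simp))

lemma h_vermaVec : h • vermaVec l₁ l₂ = l₁ • vermaVec l₁ l₂ := by
  rw [← algebraMap_smul U l₁, ← sub_eq_zero, ← sub_smul]
  exact smul_vermaVec_eq_zero.2 (Submodule.subset_span (by simp))

lemma hb_vermaVec : hb • vermaVec l₁ l₂ = l₂ • vermaVec l₁ l₂ := by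
  rw [← algebraMap_smul U l₂, ← sub_eq_zero, ← sub_smul]
  exact smul_vermaVec_eq_zero.2 (Submodule.subset_span (by simp))

/-- A central element acts on a Verma module as on the highest weight vector. -/
lemma center_smul_verma {z : U} (hz : z ∈ Subalgebra.center ℂ U) {c : ℂ}
    (hzc : z • vermaVec l₁ l₂ = c • vermaVec l₁ l₂) (m : Verma l₁ l₂) : z • m = c • m := by
  obtain ⟨u, rfl⟩ := exists_smul_vermaVec m
  rw [← mul_smul, ← Subalgebra.mem_center_iff.1 hz, mul_smul, hzc, smul_comm]

lemma casimir_smul_verma (m : Verma l₁ l₂) : casimir • m = ((l₁ + 2) * l₂) • m :=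
  center_smul_verma casimir_mem_center
    (casimir_smul e_vermaVec eb_vermaVec h_vermaVec hb_vermaVec) m

lemma casimirBar_smul_verma (m : Verma l₁ l₂) : casimirBar • m = l₂ ^ 2 • m :=
  center_smul_verma casimirBar_mem_center (casimirBar_smul eb_vermaVec hb_vermaVec) m

/-- A nonzero element of degree `k` in `f` and `f̄` is not divisible by a power `f ^ N` with
`k < N`, even after multiplication by a power of `f`. -/
lemma f_pow_smul_singularElt_ne {k N : ℕ} (hkN : k < N) (j : ℕ) (m : Verma l₁ l₂) :
    f ^ j • singularElt l₁ l₂ k • vermaVec l₁ l₂ ≠ f ^ (j + N) • m := by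
  intro heq
  obtain ⟨u, rfl⟩ := exists_smul_vermaVec m
  obtain ⟨g, hg, hg1, hgf, hgfb, hneg⟩ := exists_verma_model l₁ l₂
  rw [← sub_eq_zero, ← mul_smul, ← mul_smul, ← sub_smul, smul_vermaVec_eq_zero] at heq
  have hf : ∀ (n : ℕ) (w : U) (a b : ℤ), g (f ^ n * w) a b = g w a (b - n) := by
    intro n w a b
    induction n generalizing b with
    | zero => simp
    | succ n ih => rw [pow_succ', mul_assoc, hgf, ih]; push_cast; ring_nf
  have hfb : ∀ (n : ℕ) (w : U) (a b : ℤ), g (fb ^ n * w) a b = g w (a - n) b := by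
    intro n w a b
    induction n generalizing a with
    | zero => simp
    | succ n ih => rw [pow_succ', mul_assoc, hgfb, ih]; push_cast; ring_nf
  -- Compare coefficients of `x ^ 0 * y ^ (k + j)`. On the left only the summand `f ^ k`
  -- contributes, with coefficient `1`; on the right the `y`-exponent becomes `k - N < 0`.
  have h0 := congrFun (congrFun (hg _ heq) 0) (k + j)
  rw [map_sub, Pi.sub_apply, Pi.sub_apply, hf, hf, hneg u 0 _ (by push_cast; omega), sub_zero,
    add_sub_cancel_right, singularElt, map_sum, Finset.sum_apply, Finset.sum_apply,
    Finset.sum_eq_single 0] at h0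
  · rw [map_smul, Pi.smul_apply, Pi.smul_apply, hfb, ← mul_one (f ^ (k - 0)), hf, hg1] at h0
    simp [delta, singularCoeff] at h0
  · intro i _ hi
    rw [map_smul, Pi.smul_apply, Pi.smul_apply, hfb, ← mul_one (f ^ (k - i)), hf, hg1, delta,
      if_neg (by omega), smul_zero]
  · simp

instance : Nontrivial (Verma l₁ l₂) :=
  ⟨⟨singularElt l₁ l₂ 0 • vermaVec l₁ l₂, 0, by
    simpa using f_pow_smul_singularElt_ne (l₁ := l₁) (l₂ := l₂) zero_lt_one 0 0⟩⟩

end Verma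

/-! ### The localization -/

/-- Governs the action of `e` on fractions: it amounts to `f ^ (N+1) e f⁻ᴺ = f e - N(h + N + 1)` in
the localization. -/
lemma f_pow_mul_e (N : ℕ) : f ^ (N + 1) * e = (f * e - N * (h + (N + 1))) * f ^ N := by
  have hfh : f * h = h * f + 2 * f := by rw [comm_hf, sub_add_cancel]
  have hfe : f * e = e * f - h := by rw [comm_ef, add_sub_cancel_right]
  induction N with
  | zero => simp
  | succ N ih =>
    have h1 : f * (f * e - N * (h + (N + 1))) =
        (f * e - (N + 1 : ℕ) * (h + ((N + 1 : ℕ) + 1))) * f := by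
      have h2 : f * (f * e) = f * e * f - (h * f + 2 * f) := by
        rw [hfe, mul_sub, hfh, ← hfe]; simp only [mul_assoc]
      rw [mul_sub, h2, ← (Nat.cast_commute N f).left_comm, mul_add f, hfh, mul_add f, mul_one,
        ← (Nat.cast_commute N f).eq]
      push_cast
      noncomm_ring
    rw [pow_succ', mul_assoc, ih, ← mul_assoc, h1, mul_assoc, ← pow_succ']

section Loc

variable {M : Type} [AddCommGroup M] [Module ℂ M] [Module U M] [IsScalarTower ℂ U M]

lemma f_pow_smul_oreDiv (m : M) (N : ℕ) :
    f ^ N • (OreLocalization.oreDiv m (⟨f ^ N, N, rfl⟩ : Submonoid.powers f) : Loc M) =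
      toLoc M m := by
  rw [← OreLocalization.oreDiv_one_smul]
  exact OreLocalization.smul_cancel (s := (⟨f ^ N, N, rfl⟩ : Submonoid.powers f))

/-- `f ^ N` is invertible in the localization, so identities there may be tested after clearing
denominators. -/
lemma f_pow_smul_eq_zero {x : Loc M} (N : ℕ) (hx : f ^ N • x = 0) : x = 0 := by
  let s : Submonoid.powers f := ⟨f ^ N, N, rfl⟩
  rw [← OreLocalization.oreDiv_one_smul] at hx
  have h1 : (OreLocalization.oreDiv (1 : U) s * OreLocalization.oreDiv (f ^ N) 1) • x = 0 := by
    rw [mul_smul, hx, smul_zero]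
  have h2 : OreLocalization.oreDiv (1 : U) s *
      OreLocalization.oreDiv (f ^ N) (1 : Submonoid.powers f) = 1 :=
    OreLocalization.mul_inv 1 s
  rwa [h2, one_smul] at h1

lemma toLoc_eq {m m' : M} (h : toLoc M m = toLoc M m') : ∃ j : ℕ, f ^ j • m = f ^ j • m' := by
  obtain ⟨⟨_, j, rfl⟩, w, h1, h2⟩ := OreLocalization.oreDiv_eq_iff.1 h
  refine ⟨j, ?_⟩
  simp only [OneMemClass.coe_one, mul_one] at h2
  rw [← h2] at h1
  exact h1.symm

lemma exists_f_pow_smul_eq_toLoc (x : Loc M) : ∃ (N : ℕ) (m : M), f ^ N • x = toLoc M m := by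
  induction x using OreLocalization.ind with
  | _ m s =>
    obtain ⟨_, N, rfl⟩ := s
    exact ⟨N, m, f_pow_smul_oreDiv m N⟩

/-- A central element acting by a scalar on `M` acts by the same scalar on the localization. -/
lemma center_smul_loc {z : U} (hz : z ∈ Subalgebra.center ℂ U) {c : ℂ}
    (hzc : ∀ m : M, z • m = c • m) (x : Loc M) : z • x = c • x := by
  obtain ⟨N, m, hm⟩ := exists_f_pow_smul_eq_toLoc x
  rw [← sub_eq_zero, ← algebraMap_smul U c x, ← sub_smul]
  have hz' : z - algebraMap ℂ U c ∈ Subalgebra.center ℂ U :=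
    sub_mem hz (Subalgebra.algebraMap_mem _ c)
  refine f_pow_smul_eq_zero N ?_
  rw [← mul_smul, Subalgebra.mem_center_iff.1 hz', mul_smul, hm, ← map_smul, sub_smul, hzc,
    algebraMap_smul, sub_self, map_zero]

/-- The scalar passes from the localization to its quotient and then to a submodule. -/
lemma center_smul_enAr {z : U} (hz : z ∈ Subalgebra.center ℂ U) {c : ℂ}
    (hzc : ∀ m : M, z • m = c • m) (x : EnAr M) : z • x = c • x := by
  obtain ⟨x, hx⟩ := x
  refine Subtype.ext ?_
  change z • x = c • x
  obtain ⟨y, rfl⟩ := Submodule.Quotient.mk_surjective _ x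
  rw [← Submodule.Quotient.mk_smul, center_smul_loc hz hzc]
  rfl

lemma isLocallyFinite_of_e_smul_eq_zero {m : M} (hm : e • m = 0) : IsLocallyFinite m := by
  rw [isLocallyFinite_iff]
  refine ⟨Submodule.span ℂ {m}, inferInstance, Submodule.mem_span_singleton_self m, ?_⟩
  intro w hw
  obtain ⟨c, rfl⟩ := Submodule.mem_span_singleton.1 hw
  rw [smul_comm, hm, smul_zero]
  exact zero_mem _

end Loc

lemma nontrivial_V (n : ℤ) {l : ℂ} (hl : l ≠ 0) : Nontrivial (V n l) := by
  -- `N` is chosen so that `h + N + 1` kills weight `n - 2 - 2k`, and `k = |n|` guarantees `k < N`.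
  set k : ℕ := n.natAbs with hk
  obtain ⟨N, hN⟩ : ∃ N : ℕ, (N : ℤ) = 2 * k + 1 - n := ⟨(2 * k + 1 - n).toNat, by omega⟩
  set l₁ : ℂ := (n : ℂ) - 2 with hl₁
  set q : Verma l₁ l := singularElt l₁ l k • vermaVec l₁ l with hq
  set x : Loc (Verma l₁ l) := OreLocalization.oreDiv q (⟨f ^ N, N, rfl⟩ : Submonoid.powers f)
  have hx : f ^ N • x = toLoc _ q := f_pow_smul_oreDiv q N
  -- After multiplication by `f ^ (N+1)` this becomes `(f e - N(h + N + 1)) q = 0`, and both `e` and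
  -- `h + N + 1` kill `q`.
  have hex : e • x = 0 := by
    refine f_pow_smul_eq_zero (N + 1) ?_
    have hNn : (N : ℂ) = 2 * k + 1 - n := by exact_mod_cast hN
    have hhq : (h + (N + 1)) • q = 0 := by
      have h1 : ((N : U) + 1) • q = ((N : ℂ) + 1) • q := by
        rw [← algebraMap_smul U ((N : ℂ) + 1)]; simp
      rw [add_smul, h1, h_smul_singularElt h_vermaVec, ← add_smul, hNn, hl₁]
      have : (n : ℂ) - 2 - 2 * k + (2 * k + 1 - n + 1) = 0 := by ring
      rw [this, zero_smul]
    rw [← mul_smul, f_pow_mul_e, mul_smul, hx, ← map_smul, sub_smul, mul_smul, mul_smul, hhq,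
      e_smul_singularElt hl e_vermaVec h_vermaVec hb_vermaVec]
    simp
  let y : Twist (Verma l₁ l) := Submodule.Quotient.mk x
  -- If `f⁻ᴺ q` came from `m` in the Verma module, then `f ^ j q = f ^ (j + N) m` for some `j`,
  -- against the degree bound.
  have hy : y ≠ 0 := by
    intro h0
    obtain ⟨m, hm⟩ := (Submodule.Quotient.mk_eq_zero _).1 h0
    rw [← hm, ← map_smul] at hx
    obtain ⟨j, hj⟩ := toLoc_eq hx
    rw [← mul_smul, ← pow_add] at hj
    exact f_pow_smul_singularElt_ne (by omega) j m hj.symm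
  have hey : e • y = 0 := by
    rw [← Submodule.Quotient.mk_smul, hex]; rfl
  exact ⟨⟨⟨y, isLocallyFinite_of_e_smul_eq_zero hey⟩, 0, fun h0 => hy (congrArg Subtype.val h0)⟩⟩

/-! ### Annihilators of the Verma modules and of `V(n, l)` -/

lemma annihilator_verma (l₁ : ℂ) {l₂ : ℂ} (hl₂ : l₂ ≠ 0) :
    Module.annihilator U (Verma l₁ l₂) = casimirIdeal ((l₁ + 2) * l₂) (l₂ ^ 2) :=
  annihilator_eq_casimirIdeal (pow_ne_zero 2 hl₂) _ casimir_smul_verma casimirBar_smul_verma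

lemma annihilator_V (n : ℤ) {l : ℂ} (hl : l ≠ 0) :
    Module.annihilator U (V n l) = casimirIdeal (n * l) (l ^ 2) := by
  have := nontrivial_V n hl
  refine annihilator_eq_casimirIdeal (pow_ne_zero 2 hl) _
    (center_smul_enAr casimir_mem_center fun m => ?_)
    (center_smul_enAr casimirBar_mem_center casimirBar_smul_verma)
  rw [casimir_smul_verma, sub_add_cancel]

/-- The ideal is the annihilator of the nonzero module `Δ(a - 2, b)`, hence proper. -/
lemma nontrivial_quotient (a : ℂ) {b : ℂ} (hb : b ≠ 0) :
    Nontrivial (U ⧸ casimirIdeal (a * b) (b ^ 2)) := by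
  rw [show a = (a - 2) + 2 by ring, ← annihilator_verma (a - 2) hb]
  refine Ideal.Quotient.nontrivial_iff.2 fun h0 => ?_
  have h1 : (1 : U) ∈ Module.annihilator U (Verma (a - 2) b) := h0 ▸ Submodule.mem_top
  obtain ⟨m, hm⟩ := exists_ne (0 : Verma (a - 2) b)
  exact hm (by simpa using Module.mem_annihilator.1 h1 m)

end TakiffSl2

end

theorem theorem4p23 (n : ℤ) (lam₂ : ℂ) (hlam₂ : lam₂ ≠ 0) :
    Module.annihilator TakiffSl2.U (TakiffSl2.V n lam₂) =
        Module.annihilator TakiffSl2.U (TakiffSl2.Verma ((n : ℂ) - 2) lam₂) ∧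
      Module.annihilator TakiffSl2.U (TakiffSl2.V n lam₂) =
        Module.annihilator TakiffSl2.U (TakiffSl2.Verma (-(n : ℂ) - 2) (-lam₂)) ∧
      (∃! χ : TakiffSl2.Z →ₐ[ℂ] ℂ,
        χ TakiffSl2.C = (n : ℂ) * lam₂ ∧ χ TakiffSl2.Cbar = lam₂ ^ 2) ∧
      (∀ χ : TakiffSl2.Z →ₐ[ℂ] ℂ,
        χ TakiffSl2.C = (n : ℂ) * lam₂ → χ TakiffSl2.Cbar = lam₂ ^ 2 →
          Module.annihilator TakiffSl2.U (TakiffSl2.V n lam₂) = TakiffSl2.idealOfKer χ) ∧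
      Module.annihilator TakiffSl2.U (TakiffSl2.V n lam₂) =
        Ideal.span {TakiffSl2.casimir - algebraMap ℂ TakiffSl2.U ((n : ℂ) * lam₂),
          TakiffSl2.casimirBar - algebraMap ℂ TakiffSl2.U (lam₂ ^ 2)} := by
  have hV := TakiffSl2.annihilator_V n hlam₂
  have := TakiffSl2.nontrivial_quotient n hlam₂
  have hsq : lam₂ ^ 2 ≠ 0 := pow_ne_zero 2 hlam₂
  obtain ⟨χ₀, hC, hCbar, hker⟩ := TakiffSl2.exists_character ((n : ℂ) * lam₂) hsq
  have huniq : ∀ χ : TakiffSl2.Z →ₐ[ℂ] ℂ, χ TakiffSl2.C = (n : ℂ) * lam₂ →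
      χ TakiffSl2.Cbar = lam₂ ^ 2 → χ = χ₀ := fun χ h1 h2 =>
    TakiffSl2.character_ext (by rw [h2]; exact hsq) (h1.trans hC.symm) (h2.trans hCbar.symm)
  refine ⟨?_, ?_, ⟨χ₀, ⟨hC, hCbar⟩, fun χ hχ => huniq χ hχ.1 hχ.2⟩, fun χ h1 h2 => ?_, hV⟩
  · rw [hV, TakiffSl2.annihilator_verma _ hlam₂, sub_add_cancel]
  · rw [hV, TakiffSl2.annihilator_verma _ (neg_ne_zero.2 hlam₂), sub_add_cancel, neg_mul_neg,
      neg_sq]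
  · rw [hV, huniq χ h1 h2, hker]
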